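/- **Conventions.** A *filtered space* of lowest index $l\ge 0$ and length $n\ge 0$ is a Hausdorff space $Q$ with closed subsets $Q=Q_{l+n}\supsetneq Q_{l+n-1}\supseteq\dots\supseteq Q_l\supsetneq Q_{l-1}=\emptyset$; the *strata* of dimension $i$ are the connected components of $Q_i\setminus Q_{i-1}$. The open cone on a compact Hausdorff space $L$ is $\mathring c(L)=L\times[0,1)/L\times\{0\}$, with $\mathring c(\emptyset)$ a point. *Topological manifolds* are Hausdorff, second countable and locally Euclidean of some fixed dimension. A $0$-dimensional *topological stratified pseudomanifold* is a nonempty discrete space. For $l+n>0$, an $(l+n)$-dimensional one is a filtered space of lowest index $l$ and length $n$ such that every $(l+i)$-dimensional stratum is an $(l+i)$-manifold, $Q_{l+n}\setminus Q_{l+n-1}$ is dense, and every $p\in Q_{l+i}\setminus Q_{l+i-1}$ has an open neighbourhood $U$ with a homeomorphism $\varphi:U\to O\times\mathring c(L)$, where $O\subset\mathbb R^{l+i}$ is open and contractible, $L$ is a compact $(n-i-1)$-dimensional topological stratified pseudomanifold or empty (always empty if $i=n$), and $\varphi(U\cap Q_{l+i+j+1})=O\times\mathring c(L_j)$ for $-1\le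 j\le n-i-1$. Any such $L$ is a *link* of $p$. The pseudomanifold is *normal* if all links of all its points are connected (the empty link counts as connected). Let $l\ge 0$, $m\ge n\ge 0$, and let $T=T^m=U(1)^m$ act continuously and effectively on a second countable compact Hausdorff space $X$ such that every isotropy group $T_x$ is a subtorus. Put $X_{l+2i+(m-n)}=X_{l+2i+1+(m-n)}=\{x:\dim T(x)\le i+(m-n)\}$, where $T(x)$ is the orbit of $x$. $X$ is an $(l+m+n)$-dimensional *locally standard $T$-pseudomanifold* (with parameters $l,m,n$) if, with this filtration, $X$ is a topological stratified pseudomanifold of lowest index $l+m-n$ and length $2n$ (in particular $X_{l-1+(m-n)}=\emptyset$), and the following holds, recursively in $l+n$. If $l=n=0$, then $X$ is equivariantly homeomorphic to a finite disjoint union of copies of $T^m$ with the multiplication action. If $l+n>0$, then every $x\in X_{l+2i+(m-n)}\setminus X_{l+2(i-1)+(m-n)}$ with $0\le i\le n$ has a $T$-invariant open neighbourhood $U$ and a weakly equivariant homeomorphism $U\to O\times(\Omega\times U(1)^{m-n})\times\mathring c(L)$, where $O\subset\mathbb R^l$ is open and contractible, $\Omega\subset(\mathbb C^\times)^i$ is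 open and $U(1)^i$-invariant, and $L$ is a $(2n-2i-1)$-dimensional locally standard $T_x$-pseudomanifold, $T_x\cong T^{n-i}$, or empty (always empty if $i=n$). Here $T$ acts via an isomorphism $T\cong T/T_x\times T_x\cong U(1)^{i+(m-n)}\times T^{n-i}$, the first factor by multiplication on $\Omega\times U(1)^{m-n}$ and the second through $L$ on $\mathring c(L)$. Any such $L$ is a *torus link* of $x$. The orbit space $Q=X/T$ carries the filtration $Q_{l+i}=X_{l+2i+(m-n)}/T$, with lowest index $l$ and length $n$. **Statement.** Let $X$ be a locally standard $T$-pseudomanifold with $\dim X=l+m+n\le 3$ and let $Q=X/T$. The following are equivalent: 1. $X$ is a topological manifold; 2. $X$, with the filtration by orbit dimension, is a normal topological stratified pseudomanifold; 3. all torus links of all points of $X$ are connected; 4. the orbit space $Q$, with its filtration, is a normal topological stratified pseudomanifold. -/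

import Mathlib

open Set Topology

universe u

/-! ### Topological manifolds -/

/-- `M` is a `k`-dimensional topological manifold: Hausdorff, second countable and locally
homeomorphic to `ℝ^k`. -/
def IsManifoldOfDim (k : ℕ) (M : Type u) [TopologicalSpace M] : Prop :=
  T2Space M ∧ SecondCountableTopology M ∧
    Nonempty (ChartedSpace (EuclideanSpace ℝ (Fin k)) M)

/-- `M` is a topological manifold (of some dimension). -/
def IsTopologicalManifold (M : Type u) [TopologicalSpace M] : Prop :=
  ∃ k : ℕ, IsManifoldOfDim k M

/-! ### Open cones -/

/-- `L × [0, 1)` together with one extra point. The extra point serves only to make the cone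
on the empty space a single point. -/
abbrev PreCone (L : Type u) : Type u := (L × Ico (0 : ℝ) 1) ⊕ Unit

/-- The points of `PreCone L` that are collapsed to the cone vertex: all of `L × {0}`, and the
extra point. -/
def PreCone.IsApex {L : Type u} : PreCone L → Prop
  | Sum.inl p => (p.2 : ℝ) = 0
  | Sum.inr _ => True

/-- The equivalence relation that collapses all apex points to one point. -/
def coneSetoid (L : Type u) : Setoid (PreCone L) where
  r a b := a = b ∨ (a.IsApex ∧ b.IsApex)
  iseqv :=
    { refl := fun _ => Or.inl rfl
      symm := by
        rintro a b (h | ⟨h, h'⟩)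
        · exact Or.inl h.symm
        · exact Or.inr ⟨h', h⟩
      trans := by
        rintro a b c (rfl | ⟨h, h'⟩) (rfl | ⟨k, k'⟩)
        · exact Or.inl rfl
        · exact Or.inr ⟨k, k'⟩
        · exact Or.inr ⟨h, h'⟩
        · exact Or.inr ⟨h, k'⟩ }

/-- The open cone `L × [0, 1) / L × {0}` with the quotient topology; for empty `L` it is a
single point. -/
def OpenCone (L : Type u) : Type u := Quotient (coneSetoid L)

instance (L : Type u) [TopologicalSpace L] : TopologicalSpace (OpenCone L) :=
  inferInstanceAs (TopologicalSpace (Quotient (coneSetoid L)))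

namespace OpenCone

variable {L : Type u}

/-- The class `[v, s]` of `(v, s) ∈ L × [0, 1)`. -/
def mk (v : L) (s : Ico (0 : ℝ) 1) : OpenCone L := Quotient.mk (coneSetoid L) (Sum.inl (v, s))

/-- The cone vertex. -/
def vertex : OpenCone L := Quotient.mk (coneSetoid L) (Sum.inr ())

/-- The cone on a subset `A ⊆ L`, as a subset of the cone on `L`. It always contains the
vertex, so the cone on `∅` is the vertex alone. -/
def sub (A : Set L) : Set (OpenCone L) := {y | y = vertex ∨ ∃ v ∈ A, ∃ s, y = mk v s}

/-- The map `[v, s] ↦ [f v, s]` induced by `f : L → L`. -/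
def map (f : L → L) : OpenCone L → OpenCone L :=
  Quotient.map (Sum.map (Prod.map f id) id) (by
    rintro a b (rfl | ⟨h, h'⟩)
    · exact Or.inl rfl
    · refine Or.inr ⟨?_, ?_⟩
      · rcases a with a | a
        · exact h
        · trivial
      · rcases b with b | b
        · exact h'
        · trivial)

theorem map_mk (f : L → L) (v : L) (s : Ico (0 : ℝ) 1) : map f (mk v s) = mk (f v) s := rfl

theorem map_vertex (f : L → L) : map f vertex = vertex := rfl

theorem mk_eq_vertex_iff (v : L) (s : Ico (0 : ℝ) 1) : mk v s = vertex ↔ (s : ℝ) = 0 := by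
  constructor
  · intro h
    rcases Quotient.exact h with h | ⟨h, -⟩
    · cases h
    · exact h
  · intro h
    exact Quotient.sound (Or.inr ⟨h, trivial⟩)

end OpenCone

/-! ### Topological stratified pseudomanifolds -/

/-- `Q` with the subsets `F j` is a filtered space with lowest index `l` and length `n`:
`Q = F (l+n) ⊋ F (l+n-1) ⊇ ⋯ ⊇ F l ⊋ F (l-1) = ∅` are closed subsets of a Hausdorff space. -/
structure IsFilteredSpace (l n : ℕ) (Q : Type u) [TopologicalSpace Q] (F : ℤ → Set Q) :
    Prop where
  t2 : T2Space Q
  closed : ∀ j, IsClosed (F j)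
  mono : Monotone F
  top : F (l + n) = univ
  top_proper : F (l + n - 1) ≠ univ
  bot_nonempty : (F l).Nonempty
  bot : F (l - 1) = ∅

/-- A filtered chart at `p`, a point of the stratum dimension `k` and codimension `c`, modelled
on the space `L` with the filtration `G`: an open neighbourhood `U` of `p`, a contractible open
set `O ⊆ ℝ^k` and a homeomorphism `φ : U → O × c(L)` with
`φ (U ∩ F (k+j+1)) = O × c(G j)` for `-1 ≤ j ≤ c-1`. -/
def HasLinkChart {Q : Type u} [TopologicalSpace Q] (F : ℤ → Set Q) (k c : ℕ) (p : Q)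
    (L : Type u) [TopologicalSpace L] (G : ℤ → Set L) : Prop :=
  ∃ U : Set Q, IsOpen U ∧ p ∈ U ∧
    ∃ O : Set (EuclideanSpace ℝ (Fin k)), IsOpen O ∧ ContractibleSpace O ∧
      ∃ φ : U ≃ₜ O × OpenCone L,
        G (-1) = ∅ ∧
        ∀ j : ℤ, -1 ≤ j → j ≤ c - 1 → ∀ y : U,
          (y : Q) ∈ F (k + j + 1) ↔ (φ y).2 ∈ OpenCone.sub (G j)

/-- `(Q, F)` is an `(l+n)`-dimensional topological stratified pseudomanifold whose filtration
has lowest index `l` and length `n`. In dimension zero it is a discrete space. A link of a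
point of `F (l+i) \ F (l+i-1)` is a compact stratified pseudomanifold of dimension `n-i-1`
or empty; in particular it is empty for `i = n`. -/
def IsStratPseudomanifold (l n : ℕ) (Q : Type u) [TopologicalSpace Q] (F : ℤ → Set Q) : Prop :=
  IsFilteredSpace l n Q F ∧
  (l + n = 0 → DiscreteTopology Q) ∧
  (l + n ≠ 0 →
    (∀ i : ℕ, i ≤ n → ∀ p ∈ F (l + i) \ F (l + i - 1),
      IsManifoldOfDim (l + i) (connectedComponentIn (F (l + i) \ F (l + i - 1)) p)) ∧
    Dense (F (l + n) \ F (l + n - 1)) ∧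
    (∀ i : ℕ, i ≤ n → ∀ p ∈ F (l + i) \ F (l + i - 1),
      ∃ (L : Type u) (_ : TopologicalSpace L) (G : ℤ → Set L),
        CompactSpace L ∧
        (IsEmpty L ∨ ∃ (l' n' : ℕ) (_ : l' + n' + i + 1 = n), IsStratPseudomanifold l' n' L G) ∧
        HasLinkChart F (l + i) (n - i) p L G))
termination_by l + n
decreasing_by omega

/-- `(L, G)` is a link of the point `p ∈ F (l+i) \ F (l+i-1)` in `(Q, F)`. -/
def IsLink (l n : ℕ) {Q : Type u} [TopologicalSpace Q] (F : ℤ → Set Q) (i : ℕ) (p : Q)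
    (L : Type u) [TopologicalSpace L] (G : ℤ → Set L) : Prop :=
  CompactSpace L ∧
  (IsEmpty L ∨ ∃ l' n' : ℕ, l' + n' + i + 1 = n ∧ IsStratPseudomanifold l' n' L G) ∧
  HasLinkChart F (l + i) (n - i) p L G

/-- A normal topological stratified pseudomanifold: the links of all points are connected,
where the empty link (of a point of a top stratum) counts as connected. -/
def IsNormalStrat (l n : ℕ) (Q : Type u) [TopologicalSpace Q] (F : ℤ → Set Q) : Prop :=
  IsStratPseudomanifold l n Q F ∧
  ∀ i : ℕ, i ≤ n → ∀ p ∈ F (l + i) \ F (l + i - 1),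
    ∀ (L : Type u) [TopologicalSpace L] (G : ℤ → Set L), IsLink l n F i p L G →
      PreconnectedSpace L

/-! ### Torus actions -/

/-- The `m`-dimensional torus `U(1)^m`. -/
abbrev Torus (m : ℕ) : Type := Fin m → Circle

/-- The standard action of `U(1)^i` on `(ℂ^×)^i`. -/
noncomputable def torusMul {i : ℕ} (t : Torus i) (w : Fin i → ℂˣ) : Fin i → ℂˣ :=
  fun a => Circle.toUnits (t a) * w a

/-- The orbit of `x` has dimension `k`: the isotropy subgroup of `x` is a torus of
dimension `m - k`. -/
def HasOrbitDim (m : ℕ) {X : Type u} [MulAction (Torus m) X] (x : X) (k : ℕ) : Prop :=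
  ∃ r : ℕ, k + r = m ∧ Nonempty (MulAction.stabilizer (Torus m) x ≃ₜ* Torus r)

/-- The filtration by orbit dimension: for `j = l + 2 i + (m - n)` and for
`j = l + 2 i + 1 + (m - n)` the set `X_j` consists of the points whose orbit has dimension at
most `i + (m - n)`; see `mem_orbitFiltration_even` and `mem_orbitFiltration_odd`. -/
def orbitFiltration (l m n : ℕ) (X : Type u) [MulAction (Torus m) X] (j : ℤ) : Set X :=
  {x | ∃ k : ℕ, HasOrbitDim m x k ∧ (l : ℤ) + 2 * k ≤ j + (m - n)}

theorem mem_orbitFiltration_even (l m n : ℕ) {X : Type u} [MulAction (Torus m) X] (i : ℤ)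
    (x : X) : x ∈ orbitFiltration l m n X (l + 2 * i + (m - n)) ↔
      ∃ k : ℕ, HasOrbitDim m x k ∧ (k : ℤ) ≤ i + (m - n) :=
  exists_congr fun _ => and_congr_right fun _ => by constructor <;> intro h <;> omega

theorem mem_orbitFiltration_odd (l m n : ℕ) {X : Type u} [MulAction (Torus m) X] (i : ℤ)
    (x : X) : x ∈ orbitFiltration l m n X (l + 2 * i + 1 + (m - n)) ↔
      ∃ k : ℕ, HasOrbitDim m x k ∧ (k : ℤ) ≤ i + (m - n) :=
  exists_congr fun _ => and_congr_right fun _ => by constructor <;> intro h <;> omega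

/-- The orbit space `X / T`, with the quotient topology. -/
abbrev OrbitSpace (m : ℕ) (X : Type u) [MulAction (Torus m) X] : Type u :=
  Quotient (MulAction.orbitRel (Torus m) X)

/-- The induced filtration of the orbit space: its `(l+i)`-skeleton is the image of
`X_{l+2i+(m-n)}`. -/
def orbitSpaceFiltration (l m n : ℕ) (X : Type u) [MulAction (Torus m) X] (j : ℤ) :
    Set (OrbitSpace m X) :=
  Quotient.mk (MulAction.orbitRel (Torus m) X) ''
    orbitFiltration l m n X (l + 2 * (j - l) + (m - n))

/-! ### Locally standard torus pseudomanifolds -/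

/-- An equivariant chart at `x` modelled on the `T^(n-i)`-space `L`: a `T`-invariant open
neighbourhood `U` of `x`, a contractible open `O ⊆ ℝ^l`, a `U(1)^i`-invariant open
`Ω ⊆ (ℂ^×)^i`, an isomorphism `ψ : T^m ≅ (U(1)^i × U(1)^(m-n)) × T^(n-i)` that identifies the
isotropy subgroup of `x` with the last factor, and a homeomorphism
`φ : U → O × (Ω × U(1)^(m-n)) × c(L)` that is equivariant along `ψ`. -/
def HasTorusChart (l m n i : ℕ) {X : Type u} [TopologicalSpace X] [MulAction (Torus m) X]
    (x : X) (L : Type u) [TopologicalSpace L] [MulAction (Torus (n - i)) L] : Prop :=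
  ∃ U : Set X, IsOpen U ∧ x ∈ U ∧
    ∃ hU : ∀ (t : Torus m), ∀ y ∈ U, t • y ∈ U,
    ∃ O : Set (EuclideanSpace ℝ (Fin l)), IsOpen O ∧ ContractibleSpace O ∧
    ∃ Ω : Set (Fin i → ℂˣ), IsOpen Ω ∧ (∀ (t : Torus i), ∀ w ∈ Ω, torusMul t w ∈ Ω) ∧
    ∃ ψ : Torus m ≃ₜ* (Torus i × Torus (m - n)) × Torus (n - i),
      (∀ t : Torus m, t ∈ MulAction.stabilizer (Torus m) x ↔ (ψ t).1 = 1) ∧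
      ∃ φ : U ≃ₜ O × (Ω × Torus (m - n)) × OpenCone L,
        ∀ (t : Torus m) (y : U),
          (φ ⟨t • (y : X), hU t y y.2⟩).1 = (φ y).1 ∧
          ((φ ⟨t • (y : X), hU t y y.2⟩).2.1.1 : Fin i → ℂˣ) =
            torusMul (ψ t).1.1 ((φ y).2.1.1 : Fin i → ℂˣ) ∧
          (φ ⟨t • (y : X), hU t y y.2⟩).2.1.2 = (ψ t).1.2 * (φ y).2.1.2 ∧
          (φ ⟨t • (y : X), hU t y y.2⟩).2.2 =
            OpenCone.map (fun v => (ψ t).2 • v) (φ y).2.2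

/-- `X` is an `(l+m+n)`-dimensional locally standard `T^m`-pseudomanifold. The requirement that
`X` with the filtration by orbit dimension be a stratified pseudomanifold of lowest index
`l + (m - n)` and length `2 n` contains `X_{l-1+(m-n)} = ∅` and the existence of free orbits.
A link of a point of `X_{l+2i+(m-n)} \ X_{l+2(i-1)+(m-n)}` is a locally standard
`T^(n-i)`-pseudomanifold of dimension `2 n - 2 i - 1 = l' + (n - i) + n'`, or empty; in
particular it is empty for `i = n`. -/
def IsLocallyStandard (l m n : ℕ) (X : Type u) [TopologicalSpace X] [MulAction (Torus m) X] :
    Prop :=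
  n ≤ m ∧
  CompactSpace X ∧ T2Space X ∧ SecondCountableTopology X ∧
  ContinuousSMul (Torus m) X ∧ FaithfulSMul (Torus m) X ∧
  (∀ x : X, IsClosed (MulAction.stabilizer (Torus m) x : Set (Torus m)) ∧
    IsConnected (MulAction.stabilizer (Torus m) x : Set (Torus m))) ∧
  IsStratPseudomanifold (l + (m - n)) (2 * n) X (orbitFiltration l m n X) ∧
  (l + n = 0 → ∃ (N : ℕ) (φ : X ≃ₜ Fin N × Torus m),
    ∀ (t : Torus m) (x : X), φ (t • x) = ((φ x).1, t * (φ x).2)) ∧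
  (l + n ≠ 0 → ∀ i : ℕ, i ≤ n →
    ∀ x ∈ orbitFiltration l m n X (l + 2 * i + (m - n)) \
        orbitFiltration l m n X (l + 2 * (i - 1) + (m - n)),
      ∃ (L : Type u) (_ : TopologicalSpace L) (_ : MulAction (Torus (n - i)) L),
        (IsEmpty L ∨
          ∃ (l' n' : ℕ) (_ : l' + n' + i + 1 = n), IsLocallyStandard l' (n - i) n' L) ∧
        HasTorusChart l m n i x L)
termination_by l + n
decreasing_by omega

/-- `L` is a link of `x ∈ X_{l+2i+(m-n)} \ X_{l+2(i-1)+(m-n)}` in the sense of locally standard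
torus pseudomanifolds. -/
def IsTorusLink (l m n i : ℕ) {X : Type u} [TopologicalSpace X] [MulAction (Torus m) X] (x : X)
    (L : Type u) [TopologicalSpace L] [MulAction (Torus (n - i)) L] : Prop :=
  (IsEmpty L ∨ ∃ l' n' : ℕ, l' + n' + i + 1 = n ∧ IsLocallyStandard l' (n - i) n' L) ∧
  HasTorusChart l m n i x L

/-- All links, in the sense of locally standard torus pseudomanifolds, are connected (the empty
link counts as connected). -/
def HasConnectedTorusLinks (l m n : ℕ) (X : Type u) [TopologicalSpace X]
    [MulAction (Torus m) X] : Prop :=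
  ∀ i : ℕ, i ≤ n →
    ∀ x ∈ orbitFiltration l m n X (l + 2 * i + (m - n)) \
        orbitFiltration l m n X (l + 2 * (i - 1) + (m - n)),
      ∀ (L : Type u) [TopologicalSpace L] [MulAction (Torus (n - i)) L],
        IsTorusLink l m n i x L → PreconnectedSpace L

/-! From `n ≤ m` and `l + m + n ≤ 3` it follows that `n ≤ 1`. If `n = 0`, every orbit has dimension
`m`, all links are empty and all four conditions hold (`IsLocallyStandard.zero`).

Let `n = 1` and let `S` be the set `nonfreePoints m X`. A torus link of a point of `S` falls under
the base case of the recursion: it is a disjoint union of `N` circles, and `N ≥ 1` because the free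
points are dense. So near such a point `X` is `O × T^(m-1) × c(N circles)`, with `S` the set of
vertices, and `X / T` is `O × c(N points)`.

Each of the four conditions is shown to be equivalent to one property that mentions no link: `S`
does not separate `X` locally at any of its points. In `B × c(L)`, with `L` compact and `B` locally
connected, the set `B × {vertex}` does not separate locally if and only if `L` is connected
(`locallyPreconnectedCompl_vertex_iff`). This settles torus links and stratified links of `X` alike,
and shows that connectedness does not depend on the choice of the link. In the orbit space, an
arbitrary link is compared in the same way with the set of `N` points, which is connected exactly
when the union of `N` circles is.

For the manifold condition, if `N = 1` the cone is an open disc and `X` is locally Euclidean of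
dimension `l + m + 1`. If `N ≥ 2`, mapping one clopen part of the link to a positive ray and the
rest to a negative ray gives, near `x`, a map to a space of dimension `l + m` with `x` as its only
zero and with a section near `0` (`HasLocalRetract`, `hasLocalRetract_vertex`). In a chart at `x` of
larger dimension, the section would embed a small sphere of dimension `l + m - 1` into a punctured
vector space on which the map still detects it. Since `l + m ≤ 2`, connectedness of the punctured
space or the existence of logarithms on it excludes this. Hence a manifold structure has dimension
at most `l + m`, whereas the free points have charts of dimension `l + m + 1`; this contradicts
invariance of dimension, needed only up to dimension two (`HasEuclideanChart.le_of_le_two`). -/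

/-! ### Local retractions onto Euclidean spaces and the dimension of charts -/

/-- Near `x` there is a map `g` to `E` that vanishes at most at `x` and has a continuous right
inverse near `0`. -/
def HasLocalRetract (E : Type*) [NormedAddCommGroup E] {X : Type*} [TopologicalSpace X] (x : X) :
    Prop :=
  ∃ U : Set X, IsOpen U ∧ x ∈ U ∧ ∃ g : X → E, ContinuousOn g U ∧ (∀ y ∈ U, g y = 0 → y = x) ∧
    ∃ (σ : E → X) (ε : ℝ), 0 < ε ∧ ContinuousOn σ (Metric.ball 0 ε) ∧
      MapsTo σ (Metric.ball 0 ε) U ∧ ∀ z ∈ Metric.ball 0 ε, g (σ z) = z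

theorem HasLocalRetract.congr {E E' : Type*} [NormedAddCommGroup E] [NormedAddCommGroup E']
    [NormedSpace ℝ E] [NormedSpace ℝ E'] {X : Type*} [TopologicalSpace X] {x : X}
    (h : HasLocalRetract E x) (f : E ≃L[ℝ] E') : HasLocalRetract E' x := by
  obtain ⟨U, hU, hx, g, hg, hg0, σ, ε, hε, hσ, hσU, hgσ⟩ := h
  have hc : ContinuousAt f.symm 0 := f.symm.continuous.continuousAt
  obtain ⟨δ, hδ, hδε⟩ := Metric.mem_nhds_iff.1
    (hc (by simpa using Metric.ball_mem_nhds (0 : E) hε) : f.symm ⁻¹' Metric.ball 0 ε ∈ 𝓝 0)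
  refine ⟨U, hU, hx, f ∘ g, f.continuous.comp_continuousOn hg,
    fun y hy h0 => hg0 y hy (by simpa using h0), σ ∘ f.symm, δ, hδ,
    hσ.comp f.symm.continuous.continuousOn fun z hz => hδε hz, fun z hz => hσU (hδε hz),
    fun z hz => ?_⟩
  simp [hgσ _ (hδε hz)]

/-- The local retraction at a point with a chart, transported to the model space. -/
theorem HasLocalRetract.exists_map {E F : Type*} [NormedAddCommGroup E]
    [NormedAddCommGroup F] [NormedSpace ℝ F] {X : Type*} [TopologicalSpace X]
    {x : X} (h : HasLocalRetract E x) (e : OpenPartialHomeomorph X F) (hx : x ∈ e.source) :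
    ∃ g : F → E, Continuous g ∧ (∀ y, g y = 0 → y = 0) ∧
      ∃ (σ : E → F) (δ : ℝ), 0 < δ ∧ ContinuousOn σ (Metric.ball 0 δ) ∧
        ∀ z ∈ Metric.ball 0 δ, g (σ z) = z := by
  obtain ⟨U, hU, hxU, g, hg, hg0, σ, ε, hε, hσ, hσU, hgσ⟩ := h
  have hσ0 : σ 0 = x := hg0 _ (hσU (Metric.mem_ball_self hε)) (hgσ 0 (Metric.mem_ball_self hε))
  have hopen : IsOpen (e.target ∩ e.symm ⁻¹' U) := e.symm.isOpen_inter_preimage hU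
  obtain ⟨r, hr, hrU⟩ := Metric.isOpen_iff.1 hopen (e x)
    ⟨e.map_source hx, by simpa [e.left_inv hx] using hxU⟩
  -- Parametrising a small ball about `e x` by all of `F`, with `0` going to the centre, makes the
  -- transported map continuous on the whole of `F`.
  set u : OpenPartialHomeomorph F F := OpenPartialHomeomorph.univBall (e x) r with hu
  have hus : u.source = univ := OpenPartialHomeomorph.univBall_source _ _
  have hut : u.target = Metric.ball (e x) r := OpenPartialHomeomorph.univBall_target _ hr
  have huc : Continuous u := OpenPartialHomeomorph.continuous_univBall _ _
  have humem : ∀ y, u y ∈ Metric.ball (e x) r := fun y => hut ▸ u.map_source (hus ▸ mem_univ y)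
  have hσx : ContinuousAt σ 0 := hσ.continuousAt (Metric.ball_mem_nhds _ hε)
  have hnear : ∀ᶠ z in 𝓝 (0 : E), σ z ∈ e.source ∩ e ⁻¹' Metric.ball (e x) r := by
    apply hσx
    rw [hσ0]
    exact (e.isOpen_inter_preimage Metric.isOpen_ball).mem_nhds ⟨hx, Metric.mem_ball_self hr⟩
  obtain ⟨δ, hδ, hδs⟩ := Metric.eventually_nhds_iff_ball.1
    (hnear.and (Metric.ball_mem_nhds (0 : E) hε))
  refine ⟨fun y => g (e.symm (u y)), ?_, fun y hy => ?_, fun z => u.symm (e (σ z)), δ, hδ, ?_, ?_⟩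
  · rw [← continuousOn_univ]
    refine hg.comp ((e.continuousOn_symm.comp huc.continuousOn fun y _ => (hrU (humem y)).1)) ?_
    exact fun y _ => (hrU (humem y)).2
  · have h1 : e.symm (u y) = x := hg0 _ (hrU (humem y)).2 hy
    have h2 : u y = e x := by rw [← h1, e.right_inv (hrU (humem y)).1]
    have h3 : u y = u 0 := by rw [h2, hu, OpenPartialHomeomorph.univBall_apply_zero]
    exact u.injOn (hus ▸ mem_univ y) (hus ▸ mem_univ _) h3
  · refine u.continuousOn_symm.comp (e.continuousOn.comp
      (hσ.mono fun z hz => (hδs z hz).2) fun z hz => (hδs z hz).1.1) fun z hz => ?_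
    rw [hut]
    exact (hδs z hz).1.2
  · intro z hz
    simp only
    rw [u.right_inv (by rw [hut]; exact (hδs z hz).1.2), e.left_inv (hδs z hz).1.1,
      hgσ z (hδs z hz).2]

/-- The complement of a closed ray from the origin is simply connected. -/
theorem isSimplyConnected_compl_ray {F : Type*} [NormedAddCommGroup F] [NormedSpace ℝ F] (v : F)
    (hv : v ≠ 0) : IsSimplyConnected {y : F | ∀ t : ℝ, 0 ≤ t → y ≠ -(t • v)} := by
  have hvmem : v ∈ {y : F | ∀ t : ℝ, 0 ≤ t → y ≠ -(t • v)} := by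
    intro t ht h
    have : (1 + t) • v = 0 := by rw [add_smul, one_smul]; nth_rw 1 [h]; simp
    rcases smul_eq_zero.1 this with h | h
    · linarith
    · exact hv h
  -- If the segment from `v` to `y` met the removed ray at `-(t • v)`, solving for `y` would put `y`
  -- on that ray too, at parameter `b⁻¹ * (t + a)`.
  have hs : StarConvex ℝ v {y : F | ∀ t : ℝ, 0 ≤ t → y ≠ -(t • v)} := by
    intro y hy a b ha hb hab t ht h
    rcases hb.eq_or_lt with rfl | hb
    · have ha1 : a = 1 := by linarith
      subst ha1
      exact hvmem t ht (by simpa using h)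
    · refine hy (b⁻¹ * (t + a)) (by positivity) ?_
      have : b • y = -((t + a) • v) := by
        rw [add_smul, neg_add, ← h]; abel
      rw [mul_smul, ← smul_neg, ← this, smul_smul, inv_mul_cancel₀ hb.ne', one_smul]
  have := hs.contractibleSpace ⟨v, hvmem⟩
  exact SimplyConnectedSpace.ofContractible _

theorem isOpen_compl_ray {F : Type*} [NormedAddCommGroup F] [NormedSpace ℝ F] (v : F)
    (hv : v ≠ 0) : IsOpen {y : F | ∀ t : ℝ, 0 ≤ t → y ≠ -(t • v)} := by
  have hcl : IsClosedEmbedding fun t : ℝ => -(t • v) := by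
    have := isClosedEmbedding_smul_left (𝕜 := ℝ) hv
    exact (Homeomorph.neg F).isClosedEmbedding.comp this
  have := (hcl.isClosedMap _ (isClosed_Ici (a := (0 : ℝ)))).isOpen_compl
  convert this using 1
  ext y
  simp only [mem_ofPred_eq, mem_compl_iff, mem_image, mem_Ici, not_exists, not_and, ne_eq]
  exact forall₂_congr fun t _ => not_congr eq_comm

/-- In dimension at least three, nowhere vanishing functions on a punctured vector space have
continuous logarithms. -/
theorem exists_log_of_two_lt_finrank {F : Type*} [NormedAddCommGroup F] [NormedSpace ℝ F]
    [FiniteDimensional ℝ F] (hF : 2 < Module.finrank ℝ F) {g : F → ℂ} (hg : Continuous g)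
    (hg0 : ∀ y, g y = 0 → y = 0) :
    ∃ f : F → ℂ, ContinuousOn f {0}ᶜ ∧ ∀ y, y ≠ 0 → Complex.exp (f y) = g y := by
  classical
  have : Nontrivial F := Module.nontrivial_of_finrank_pos (R := ℝ) (by omega)
  obtain ⟨v, hv⟩ := exists_ne (0 : F)
  have key : ∀ w : F, w ≠ 0 → ∃ f : F → ℂ,
      ContinuousOn f {y : F | ∀ t : ℝ, 0 ≤ t → y ≠ -(t • w)} ∧
      EqOn (Complex.exp ∘ f) g {y : F | ∀ t : ℝ, 0 ≤ t → y ≠ -(t • w)} := fun w hw =>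
    Complex.exists_continuousOn_eqOn_exp_comp (isSimplyConnected_compl_ray w hw)
      (isOpen_compl_ray w hw) hg.continuousOn (by
        rintro ⟨y, hy, h0⟩
        exact hy 0 le_rfl (by simpa using hg0 y h0))
  obtain ⟨f₁, hf₁, he₁⟩ := key v hv
  obtain ⟨f₂, hf₂, he₂⟩ := key (-v) (neg_ne_zero.2 hv)
  set D₁ := {y : F | ∀ t : ℝ, 0 ≤ t → y ≠ -(t • v)} with hD₁
  set D₂ := {y : F | ∀ t : ℝ, 0 ≤ t → y ≠ -(t • -v)} with hD₂
  have hsub : ∀ y : F, y ∈ (Submodule.span ℝ {v} : Set F)ᶜ ↔ y ∈ D₁ ∧ y ∈ D₂ := by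
    intro y
    simp only [mem_compl_iff, SetLike.mem_coe, Submodule.mem_span_singleton, not_exists, hD₁, hD₂,
      mem_ofPred_eq]
    constructor
    · exact fun h => ⟨fun t _ ht => h (-t) (by rw [ht]; simp), fun t _ ht => h t (by rw [ht]; simp)⟩
    · rintro ⟨h₁, h₂⟩ a rfl
      rcases le_total 0 a with ha | ha
      · exact h₂ a ha (by simp)
      · exact h₁ (-a) (by linarith) (by simp)
  -- Dimension at least three enters here: the two slit spaces overlap in the complement of a line,
  -- which has codimension at least two, so the overlap is connected.
  have hcod : 1 < Module.rank ℝ (F ⧸ Submodule.span ℝ {v}) := by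
    rw [← Module.finrank_eq_rank]
    have h1 := Submodule.finrank_quotient_add_finrank (Submodule.span ℝ {v})
    rw [finrank_span_singleton hv] at h1
    exact_mod_cast (by omega : 1 < Module.finrank ℝ (F ⧸ Submodule.span ℝ {v}))
  have hconn := isConnected_compl_of_one_lt_codim hcod
  obtain ⟨y₀, hy₀⟩ := hconn.nonempty
  have hy₀' := (hsub y₀).1 hy₀
  -- The period by which the two logarithms differ at the base point. By uniqueness of lifts it is
  -- their difference on the whole overlap, so they can be glued after a shift.
  set c : ℂ := f₁ y₀ - f₂ y₀ with hc
  have hexpc : Complex.exp c = 1 := by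
    have h1 : Complex.exp (f₁ y₀) = g y₀ := he₁ hy₀'.1
    have h2 : Complex.exp (f₂ y₀) = g y₀ := he₂ hy₀'.2
    rw [hc, Complex.exp_sub, h1, h2, div_self]
    rw [← h1]
    exact Complex.exp_ne_zero _
  have hexp₂ : ∀ y ∈ D₂, Complex.exp (f₂ y + c) = g y := fun y hy => by
    rw [Complex.exp_add, hexpc, mul_one]; exact he₂ hy
  have hf₂c : ContinuousOn (fun y => f₂ y + c) D₂ := hf₂.add continuousOn_const
  have heq : EqOn f₁ (fun y => f₂ y + c) (Submodule.span ℝ {v} : Set F)ᶜ := by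
    refine Complex.isCoveringMap_exp.eqOn_of_comp_eqOn hconn.isPreconnected
      (hf₁.mono fun y hy => ((hsub y).1 hy).1) (hf₂c.mono fun y hy => ((hsub y).1 hy).2)
      (fun y hy => ?_) hy₀ (by simp [hc])
    apply Subtype.ext
    change Complex.exp (f₁ y) = Complex.exp (f₂ y + c)
    rw [hexp₂ y ((hsub y).1 hy).2]
    exact he₁ ((hsub y).1 hy).1
  set f : F → ℂ := fun y => if y ∈ D₁ then f₁ y else f₂ y + c with hf
  have hfD₁ : EqOn f f₁ D₁ := fun y hy => by simp [hf, hy]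
  have hfD₂ : EqOn f (fun y => f₂ y + c) D₂ := fun y hy => by
    by_cases h : y ∈ D₁
    · rw [hfD₁ h]; exact heq ((hsub y).2 ⟨h, hy⟩)
    · simp [hf, h]
  have hcover : ({0}ᶜ : Set F) ⊆ D₁ ∪ D₂ := by
    intro y hy
    by_contra h
    simp only [mem_union, not_or, hD₁, hD₂, mem_ofPred_eq, not_forall, not_not] at h
    obtain ⟨⟨t, ht, rfl⟩, s, hs, h⟩ := h
    have : (s + t) • v = 0 := by
      rw [add_smul]
      have : -(t • v) = s • v := by simpa using h
      rw [← this]; simp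
    rcases smul_eq_zero.1 this with h' | h'
    · have : t = 0 := by linarith
      subst this
      simp at hy
    · exact hv h'
  refine ⟨f, ?_, fun y hy => ?_⟩
  · exact ((hf₁.congr hfD₁).union_of_isOpen (hf₂c.congr hfD₂) (isOpen_compl_ray v hv)
      (isOpen_compl_ray (-v) (neg_ne_zero.2 hv))).mono hcover
  · rcases hcover hy with h | h
    · rw [hfD₁ h]; exact he₁ h
    · rw [hfD₂ h]; exact hexp₂ y h

/-- The inclusion of a circle into the punctured plane has no continuous logarithm. -/
theorem not_exists_log_circle {r : ℝ} (hr : 0 < r) (f : ℂ → ℂ)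
    (hf : ContinuousOn f (Metric.sphere 0 r)) (he : ∀ z ∈ Metric.sphere 0 r, Complex.exp (f z) = z) :
    False := by
  have hmem : ∀ θ : ℝ, (r : ℂ) * Complex.exp (θ * Complex.I) ∈ Metric.sphere (0 : ℂ) r := by
    intro θ
    simp [Complex.norm_exp_ofReal_mul_I, abs_of_pos hr]
  set l : ℝ → ℂ := fun θ => f (r * Complex.exp (θ * Complex.I)) with hl
  have hlc : Continuous l := by
    rw [← continuousOn_univ]
    exact hf.comp (by fun_prop) fun θ _ => hmem θ
  -- Both functions lift `θ ↦ r * exp (θ * I)` through the exponential and agree at `0`. The first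
  -- has period `2π`, the second has not.
  have heq := Complex.isCoveringMap_exp.eqOn_of_comp_eqOn (s := (univ : Set ℝ))
    (g₁ := l) (g₂ := fun θ => θ * Complex.I + l 0) isPreconnected_univ hlc.continuousOn
    (by fun_prop) (fun θ _ => Subtype.ext (by
      change Complex.exp (l θ) = Complex.exp (θ * Complex.I + l 0)
      rw [Complex.exp_add, hl]
      simp only
      rw [he _ (hmem θ), he _ (hmem 0)]
      simp [mul_comm])) (mem_univ 0) (by simp)
  have h2 : l (2 * Real.pi) = l 0 := by
    simp only [hl]
    congr 2
    push_cast
    rw [Complex.exp_two_pi_mul_I]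
    simp
  have h3 : l (2 * Real.pi) = _ := heq (mem_univ (2 * Real.pi))
  rw [h2] at h3
  have h4 : ((2 * Real.pi : ℝ) : ℂ) * Complex.I = 0 := by
    simpa using h3.symm
  simp [Real.pi_ne_zero] at h4

/-- A point with a local retraction to the line has no chart of dimension at least two. -/
theorem HasLocalRetract.finrank_le_one {F : Type*} [NormedAddCommGroup F] [NormedSpace ℝ F]
    [FiniteDimensional ℝ F] {X : Type*} [TopologicalSpace X] {x : X} (h : HasLocalRetract ℝ x)
    (e : OpenPartialHomeomorph X F) (hx : x ∈ e.source) : Module.finrank ℝ F ≤ 1 := by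
  by_contra! hF
  obtain ⟨g, hg, hg0, σ, δ, hδ, hσ, hgσ⟩ := h.exists_map e hx
  have hconn : IsConnected ({0}ᶜ : Set F) := isConnected_compl_singleton_of_one_lt_rank
    (by rw [← Module.finrank_eq_rank]; exact_mod_cast hF) 0
  have hm : ∀ s : ℝ, |s| < δ → s ≠ 0 → σ s ∈ ({0}ᶜ : Set F) ∧ g (σ s) = s := by
    intro s hs hs0
    have hgs := hgσ s (by simpa using hs)
    refine ⟨fun h0 => hs0 ?_, hgs⟩
    have h1 := hgσ 0 (Metric.mem_ball_self hδ)
    rw [← hgs, mem_singleton_iff.1 h0, ← hg0 _ h1, h1]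
  have hd : |δ / 2| < δ := by rw [abs_of_pos (by linarith)]; linarith
  obtain ⟨ha, ha'⟩ := hm (δ / 2) hd (by linarith)
  obtain ⟨hb, hb'⟩ := hm (-(δ / 2)) (by rwa [abs_neg]) (by linarith)
  -- On the connected punctured space `g` takes the values `±δ/2`, so it has a zero there.
  obtain ⟨y, hy, hy0⟩ := hconn.isPreconnected.intermediate_value hb ha hg.continuousOn
    (show (0 : ℝ) ∈ Icc _ _ from by rw [ha', hb']; constructor <;> linarith)
  exact hy (hg0 y hy0)

/-- A point with a local retraction to the plane has no chart of dimension at least three. -/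
theorem HasLocalRetract.finrank_le_two {F : Type*} [NormedAddCommGroup F] [NormedSpace ℝ F]
    [FiniteDimensional ℝ F] {X : Type*} [TopologicalSpace X] {x : X} (h : HasLocalRetract ℂ x)
    (e : OpenPartialHomeomorph X F) (hx : x ∈ e.source) : Module.finrank ℝ F ≤ 2 := by
  by_contra! hF
  obtain ⟨g, hg, hg0, σ, δ, hδ, hσ, hgσ⟩ := h.exists_map e hx
  obtain ⟨f, hf, hexp⟩ := exists_log_of_two_lt_finrank hF hg hg0
  have hsub : Metric.sphere (0 : ℂ) (δ / 2) ⊆ Metric.ball 0 δ :=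
    Metric.sphere_subset_ball (by linarith)
  have hne : ∀ z ∈ Metric.sphere (0 : ℂ) (δ / 2), σ z ≠ 0 := by
    intro z hz h0
    have h1 := hgσ 0 (Metric.mem_ball_self hδ)
    have h2 := hgσ z (hsub hz)
    rw [h0, ← hg0 _ h1, h1] at h2
    rw [← h2] at hz
    simp at hz
    linarith
  -- A logarithm of `g` pulled back along `σ` is a logarithm of the identity on a circle, since `g ∘
  -- σ` is the identity.
  refine not_exists_log_circle (half_pos hδ) (f ∘ σ)
    (hf.comp (hσ.mono hsub) fun z hz => hne z hz) fun z hz => ?_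
  rw [Function.comp_apply, hexp _ (hne z hz), hgσ z (hsub hz)]

/-- `x` has a chart with values in `ℝ^k`. -/
def HasEuclideanChart (k : ℕ) {X : Type*} [TopologicalSpace X] (x : X) : Prop :=
  ∃ e : OpenPartialHomeomorph X (EuclideanSpace ℝ (Fin k)), x ∈ e.source

/-- A linear identification of `E` with `ℝ` or `ℂ` reduces this to the connectedness argument and to
the logarithm argument respectively. -/
theorem HasLocalRetract.le_finrank {E : Type*} [NormedAddCommGroup E] [NormedSpace ℝ E]
    [FiniteDimensional ℝ E] {X : Type*} [TopologicalSpace X] {x : X} (h : HasLocalRetract E x)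
    (hE0 : 1 ≤ Module.finrank ℝ E) (hE : Module.finrank ℝ E ≤ 2) {k : ℕ}
    (hx : HasEuclideanChart k x) : k ≤ Module.finrank ℝ E := by
  obtain ⟨e, he⟩ := hx
  obtain hE | hE : Module.finrank ℝ E = 1 ∨ Module.finrank ℝ E = 2 := by omega
  · simpa [hE] using (h.congr (E' := ℝ)
      (ContinuousLinearEquiv.ofFinrankEq (by simpa using hE))).finrank_le_one e he
  · simpa [hE] using (h.congr (E' := ℂ) (ContinuousLinearEquiv.ofFinrankEq
      (by rw [hE, Complex.finrank_real_complex]))).finrank_le_two e he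

theorem HasEuclideanChart.hasLocalRetract {k : ℕ} {X : Type*} [TopologicalSpace X] {x : X}
    (h : HasEuclideanChart k x) : HasLocalRetract (EuclideanSpace ℝ (Fin k)) x := by
  obtain ⟨e, he⟩ := h
  obtain ⟨r, hr, hrs⟩ := Metric.isOpen_iff.1 e.open_target _ (e.map_source he)
  have hmem : ∀ z ∈ Metric.ball (0 : EuclideanSpace ℝ (Fin k)) r, z + e x ∈ e.target :=
    fun z hz => hrs (by simpa [dist_eq_norm] using hz)
  refine ⟨e.source, e.open_source, he, fun y => e y - e x, e.continuousOn.sub continuousOn_const,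
    fun y hy h0 => e.injOn hy he (sub_eq_zero.1 h0), fun z => e.symm (z + e x), r, hr, ?_, ?_, ?_⟩
  · exact e.continuousOn_symm.comp (by fun_prop) hmem
  · exact fun z hz => e.map_target (hmem z hz)
  · intro z hz
    simp [e.right_inv (hmem z hz)]

/-- Invariance of dimension in low dimensions. -/
theorem HasEuclideanChart.le_of_le_two {a b : ℕ} {X : Type*} [TopologicalSpace X] {x : X}
    (ha : HasEuclideanChart a x) (hb : HasEuclideanChart b x) (ha2 : a ≤ 2) : b ≤ a := by
  rcases Nat.eq_zero_or_pos a with rfl | ha0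
  · by_contra! hb0
    obtain ⟨e, he⟩ := ha
    obtain ⟨f, hf⟩ := hb
    -- A chart of dimension zero makes `x` isolated, which is impossible in positive dimension.
    have hopen : IsOpen {x} := by
      convert e.open_source using 1
      refine (Set.eq_singleton_iff_unique_mem.2 ⟨he, fun y hy => ?_⟩).symm
      exact e.injOn hy he (Subsingleton.elim _ _)
    have h1 : f.target ∩ f.symm ⁻¹' {x} = {f x} := by
      ext y
      constructor
      · rintro ⟨hy, h⟩
        rw [mem_singleton_iff, ← mem_singleton_iff.1 h, f.right_inv hy]
      · rintro rfl
        exact ⟨f.map_source hf, f.left_inv hf⟩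
    have h2 : IsOpen {f x} := h1 ▸ f.symm.isOpen_inter_preimage hopen
    have : Nonempty (Fin b) := ⟨⟨0, hb0⟩⟩
    exact not_isOpen_singleton (f x) h2
  · simpa using ha.hasLocalRetract.le_finrank (by simpa using Nat.succ_le_of_lt ha0) (by simpa using ha2) hb

/-! ### Open cones -/

namespace OpenCone

variable {L : Type u}

theorem eq_vertex_or (y : OpenCone L) :
    y = vertex ∨ ∃ (v : L) (s : Ico (0 : ℝ) 1), (0 : ℝ) < s ∧ y = mk v s := by
  induction y using Quotient.inductionOn with
  | h a =>
    rcases a with ⟨v, s⟩ | ⟨⟩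
    · rcases s.2.1.eq_or_lt with h | h
      · exact Or.inl ((mk_eq_vertex_iff v s).2 h.symm)
      · exact Or.inr ⟨v, s, h, rfl⟩
    · exact Or.inl rfl

theorem mk_inj {v w : L} {s t : Ico (0 : ℝ) 1} (hs : (0 : ℝ) < s) (h : mk v s = mk w t) :
    v = w ∧ s = t := by
  rcases Quotient.exact h with h | ⟨h, -⟩
  · simpa using h
  · exact absurd h hs.ne'

theorem eq_vertex_of_isEmpty [IsEmpty L] (y : OpenCone L) : y = vertex := by
  rcases y.eq_vertex_or with h | ⟨v, -⟩
  · exact h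
  · exact isEmptyElim v

theorem mem_sub_empty {y : OpenCone L} : y ∈ sub (∅ : Set L) ↔ y = vertex := by
  simp [sub]

theorem mem_sub_univ (y : OpenCone L) : y ∈ sub (univ : Set L) := by
  rcases y.eq_vertex_or with h | ⟨v, s, -, h⟩
  · exact Or.inl h
  · exact Or.inr ⟨v, mem_univ v, s, h⟩

/-- The map `[v, s] ↦ s • f v`. -/
def radial {E : Type*} [AddCommGroup E] [Module ℝ E] (f : L → E) : OpenCone L → E :=
  Quotient.lift (Sum.elim (fun p => (p.2 : ℝ) • f p.1) fun _ => 0) (by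
    have key : ∀ a : PreCone L, a.IsApex →
        Sum.elim (fun p : L × Ico (0 : ℝ) 1 => (p.2 : ℝ) • f p.1) (fun _ : Unit => 0) a = 0 := by
      rintro (⟨v, s⟩ | ⟨⟩) h
      · have : (s : ℝ) = 0 := h
        simp [this]
      · rfl
    rintro a b (rfl | ⟨h, h'⟩)
    · rfl
    · rw [key a h, key b h'])

section

variable {E : Type*} [AddCommGroup E] [Module ℝ E] (f : L → E)

@[simp]
theorem radial_mk (v : L) (s : Ico (0 : ℝ) 1) : radial f (mk v s) = (s : ℝ) • f v := rfl

@[simp]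
theorem radial_vertex : radial f vertex = 0 := rfl

theorem radial_eq_zero_iff (hf : ∀ v, f v ≠ 0) (y : OpenCone L) :
    radial f y = 0 ↔ y = vertex := by
  rcases y.eq_vertex_or with rfl | ⟨v, s, hs, rfl⟩
  · simp
  · simp [hf v, mk_eq_vertex_iff]

end

/-- The map `[v, s] ↦ [f v, s]` between cones induced by a map between their bases. -/
def push {L' : Type*} (f : L → L') : OpenCone L → OpenCone L' :=
  Quotient.map (Sum.map (Prod.map f id) id) (by
    have key : ∀ a : PreCone L, a.IsApex → PreCone.IsApex (Sum.map (Prod.map f id) id a) := by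
      rintro (a | a) h
      · exact h
      · trivial
    rintro a b (rfl | ⟨h, h'⟩)
    · exact Or.inl rfl
    · exact Or.inr ⟨key a h, key b h'⟩)

@[simp]
theorem push_mk {L' : Type*} (f : L → L') (v : L) (s : Ico (0 : ℝ) 1) :
    push f (mk v s) = mk (f v) s := rfl

@[simp]
theorem push_vertex {L' : Type*} (f : L → L') : push f vertex = vertex := rfl

theorem push_surjective {L' : Type*} {f : L → L'} (hf : Function.Surjective f) :
    Function.Surjective (push f) := by
  intro y
  rcases y.eq_vertex_or with rfl | ⟨v, s, -, rfl⟩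
  · exact ⟨vertex, rfl⟩
  · obtain ⟨w, rfl⟩ := hf v
    exact ⟨mk w s, rfl⟩

/-- The quotient map onto the cone. -/
def proj (a : PreCone L) : OpenCone L := Quotient.mk (coneSetoid L) a

theorem proj_surjective : Function.Surjective (proj : PreCone L → OpenCone L) :=
  Quotient.mk_surjective

theorem proj_eq_proj_iff {a b : PreCone L} : proj a = proj b ↔ a = b ∨ (a.IsApex ∧ b.IsApex) :=
  Quotient.eq

variable [TopologicalSpace L]

theorem isQuotientMap_proj : IsQuotientMap (proj : PreCone L → OpenCone L) :=
  isQuotientMap_quotient_mk' (s := coneSetoid L)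

theorem continuous_mk : Continuous fun p : L × Ico (0 : ℝ) 1 => mk p.1 p.2 :=
  isQuotientMap_proj.continuous.comp continuous_inl

theorem continuous_radial {E : Type*} [AddCommGroup E] [Module ℝ E] [TopologicalSpace E]
    [ContinuousSMul ℝ E] {f : L → E} (hf : Continuous f) : Continuous (radial f) := by
  refine Continuous.quotient_lift ?_ _
  refine Continuous.sumElim ?_ continuous_const
  exact (continuous_subtype_val.comp continuous_snd).smul (hf.comp continuous_fst)

theorem continuous_push {L' : Type*} [TopologicalSpace L'] {f : L → L'} (hf : Continuous f) :
    Continuous (push f) := by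
  rw [isQuotientMap_proj.continuous_iff]
  exact isQuotientMap_proj.continuous.comp ((hf.prodMap continuous_id).sumMap continuous_id)

/-- Openness can fail only at the vertex. If `W` contains it, the preimage of `W` contains every
apex point, and surjectivity of `f` lifts all apex points of the target. -/
theorem isOpenMap_push {L' : Type*} [TopologicalSpace L'] {f : L → L'} (hf : IsOpenMap f)
    (hs : Function.Surjective f) : IsOpenMap (push f) := by
  intro W hW
  have hq : IsOpen (proj ⁻¹' W) := hW.preimage isQuotientMap_proj.continuous
  have him : IsOpenMap (Sum.map (Prod.map f (id : Ico (0 : ℝ) 1 → _)) (id : Unit → Unit)) :=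
    (hf.prodMap IsOpenMap.id).sumMap IsOpenMap.id
  rw [← isQuotientMap_proj.isOpen_preimage]
  convert him _ hq using 1
  ext z
  constructor
  · rintro ⟨w, hw, hwz⟩
    obtain ⟨a, rfl⟩ := proj_surjective w
    rcases proj_eq_proj_iff.1 (show proj (Sum.map (Prod.map f id) id a) = proj z from hwz) with
      h | ⟨h₁, h₂⟩
    · exact ⟨a, hw, h⟩
    · have ha : a.IsApex := by
        rcases a with a | a
        · exact h₁
        · trivial
      have hmem : ∀ b : PreCone L, b.IsApex → b ∈ proj ⁻¹' W := by
        intro b hb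
        rw [mem_preimage, proj_eq_proj_iff.2 (Or.inr ⟨hb, ha⟩)]
        exact hw
      rcases z with ⟨v, s⟩ | ⟨⟩
      · obtain ⟨w, rfl⟩ := hs v
        exact ⟨Sum.inl (w, s), hmem _ h₂, rfl⟩
      · exact ⟨Sum.inr (), hmem _ trivial, rfl⟩
  · rintro ⟨a, ha, rfl⟩
    exact ⟨_, ha, rfl⟩

theorem isOpen_sector {A : Set L} (hA : IsOpen A) :
    IsOpen {y : OpenCone L | ∃ v ∈ A, ∃ s : Ico (0 : ℝ) 1, (0 : ℝ) < s ∧ y = mk v s} := by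
  rw [← isQuotientMap_proj.isOpen_preimage]
  have : proj ⁻¹' {y : OpenCone L | ∃ v ∈ A, ∃ s : Ico (0 : ℝ) 1, (0 : ℝ) < s ∧ y = mk v s} =
      Sum.inl '' (A ×ˢ {s : Ico (0 : ℝ) 1 | (0 : ℝ) < s}) := by
    ext z
    constructor
    · rintro ⟨v, hv, s, hs, h⟩
      rcases proj_eq_proj_iff.1 h with h | ⟨-, h⟩
      · exact ⟨(v, s), ⟨hv, hs⟩, h.symm⟩
      · exact absurd h hs.ne'
    · rintro ⟨⟨v, s⟩, ⟨hv, hs⟩, rfl⟩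
      exact ⟨v, hv, s, hs, rfl⟩
  rw [this]
  exact isOpenMap_inl _ (hA.prod (isOpen_lt continuous_const continuous_subtype_val))

/-- In the cone on a compact space, the sets of points of small height form a neighbourhood basis
of the vertex. -/
theorem exists_radial_lt_subset [CompactSpace L] {W : Set (OpenCone L)} (hW : W ∈ 𝓝 vertex) :
    ∃ ε : ℝ, 0 < ε ∧ ∀ y : OpenCone L, radial (fun _ => (1 : ℝ)) y < ε → y ∈ W := by
  obtain ⟨V, hVW, hV, hvV⟩ := mem_nhds_iff.1 hW
  -- Tube lemma: the heights at which the cone leaves `V` form a closed set, by compactness of `L`,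
  -- and this set omits `0`.
  set K : Set (L × Ico (0 : ℝ) 1) := {p | mk p.1 p.2 ∉ V} with hK
  have hKc : IsClosed K := (hV.preimage continuous_mk).isClosed_compl
  have hKi : IsClosed (Prod.snd '' K) := isClosedMap_snd_of_compactSpace _ hKc
  have h0 : (⟨0, by simp⟩ : Ico (0 : ℝ) 1) ∉ Prod.snd '' K := by
    rintro ⟨⟨v, s⟩, hp, hs⟩
    apply hp
    simp only at hs
    subst hs
    rwa [(mk_eq_vertex_iff v _).2 rfl]
  obtain ⟨ε, hε, hεs⟩ := Metric.isOpen_iff.1 hKi.isOpen_compl _ h0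
  refine ⟨ε, hε, fun y hy => hVW ?_⟩
  rcases y.eq_vertex_or with rfl | ⟨v, s, hs, rfl⟩
  · exact hvV
  · by_contra hmem
    have hsb : s ∈ Metric.ball (⟨0, by simp⟩ : Ico (0 : ℝ) 1) ε := by
      simpa [Subtype.dist_eq, abs_of_pos hs] using hy
    exact hεs hsb ⟨(v, s), hmem, rfl⟩

theorem frequently_mk_mem (v : L) {W : Set (OpenCone L)} (hW : W ∈ 𝓝 vertex) :
    ∃ s : Ico (0 : ℝ) 1, (0 : ℝ) < s ∧ mk v s ∈ W := by
  have hc : Continuous fun s : Ico (0 : ℝ) 1 => mk v s :=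
    continuous_mk.comp (by fun_prop : Continuous fun s : Ico (0 : ℝ) 1 => (v, s))
  have h0 : mk v (⟨0, by simp⟩ : Ico (0 : ℝ) 1) = vertex := (mk_eq_vertex_iff v _).2 rfl
  have := hc.continuousAt.preimage_mem_nhds (x := (⟨0, by simp⟩ : Ico (0 : ℝ) 1)) (t := W)
    (by rwa [h0])
  obtain ⟨ε, hε, hεs⟩ := Metric.mem_nhds_iff.1 this
  have hm : 0 < min (ε / 2) (1 / 2) := by positivity
  have hm1 : min (ε / 2) (1 / 2 : ℝ) < 1 := (min_le_right _ _).trans_lt (by norm_num)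
  refine ⟨⟨min (ε / 2) (1 / 2), hm.le, hm1⟩, hm, hεs ?_⟩
  simp only [Metric.mem_ball, Subtype.dist_eq, Real.dist_eq, sub_zero, abs_of_pos hm]
  exact (min_le_left _ _).trans_lt (by linarith)

end OpenCone

/-! ### Local connectedness of complements -/

/-- `x` has arbitrarily small neighbourhoods that `S` does not separate. -/
def LocallyPreconnectedCompl {X : Type*} [TopologicalSpace X] (S : Set X) (x : X) : Prop :=
  ∀ V ∈ 𝓝 x, ∃ W ∈ 𝓝 x, W ⊆ V ∧ IsPreconnected (W \ S)

theorem Topology.IsOpenEmbedding.locallyPreconnectedCompl_iff {X Y : Type*} [TopologicalSpace X]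
    [TopologicalSpace Y] {i : Y → X} (hi : IsOpenEmbedding i) (S : Set X) (y : Y) :
    LocallyPreconnectedCompl S (i y) ↔ LocallyPreconnectedCompl (i ⁻¹' S) y := by
  constructor
  · intro h V hV
    obtain ⟨W, hW, hWV, hWc⟩ := h _ (hi.isOpenMap.image_mem_nhds hV)
    refine ⟨i ⁻¹' W, hi.continuous.continuousAt.preimage_mem_nhds hW, fun z hz => ?_, ?_⟩
    · obtain ⟨z', hz', he⟩ := hWV hz
      rwa [← hi.injective he]
    · rw [← preimage_sdiff]
      refine hWc.preimage_of_isOpenMap hi.injective hi.isOpenMap ?_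
      exact fun z hz => image_subset_range _ _ (hWV hz.1)
  · intro h V hV
    obtain ⟨W, hW, hWV, hWc⟩ := h _ (hi.continuous.continuousAt.preimage_mem_nhds hV)
    refine ⟨i '' W, hi.isOpenMap.image_mem_nhds hW, image_subset_iff.2 hWV, ?_⟩
    convert hWc.image i hi.continuous.continuousOn using 1
    ext z
    constructor
    · rintro ⟨⟨w, hw, rfl⟩, hz⟩
      exact ⟨w, ⟨hw, hz⟩, rfl⟩
    · rintro ⟨w, ⟨hw, hz⟩, rfl⟩
      exact ⟨⟨w, hw, rfl⟩, hz⟩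

/-- The rays over any point of `L` reach every neighbourhood of the vertex. So the two open sectors
over a clopen set and its complement disconnect every punctured neighbourhood. Conversely, by
compactness, small neighbourhoods may be taken as a product of a connected set with a cone of small
height, and removing the vertices leaves an image of a connected set times `L × (0, ε)`. -/
theorem locallyPreconnectedCompl_vertex_iff {B : Type*} {L : Type u} [TopologicalSpace B]
    [TopologicalSpace L] [LocallyConnectedSpace B] [CompactSpace L] (b : B) :
    LocallyPreconnectedCompl {z : B × OpenCone L | z.2 = OpenCone.vertex} (b, OpenCone.vertex) ↔
      PreconnectedSpace L := by
  constructor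
  · intro h
    by_contra hL
    rw [preconnectedSpace_iff_clopen] at hL
    push Not at hL
    obtain ⟨A, hA, hA0, hA1⟩ := hL
    obtain ⟨a, ha⟩ := hA0
    obtain ⟨a', ha'⟩ := (ne_univ_iff_exists_notMem A).1 hA1
    obtain ⟨W, hW, -, hWc⟩ := h univ Filter.univ_mem
    have hW' : ∀ v : L, ∃ s : Ico (0 : ℝ) 1, (0 : ℝ) < s ∧ (b, OpenCone.mk v s) ∈ W := fun v =>
      OpenCone.frequently_mk_mem v
        ((Continuous.prodMk_right b).continuousAt.preimage_mem_nhds (t := W) hW)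
    set P : Set L → Set (B × OpenCone L) := fun A => Prod.snd ⁻¹'
      {y : OpenCone L | ∃ v ∈ A, ∃ s : Ico (0 : ℝ) 1, (0 : ℝ) < s ∧ y = OpenCone.mk v s} with hP
    have hopen : ∀ A, IsOpen A → IsOpen (P A) := fun A hA =>
      (OpenCone.isOpen_sector hA).preimage continuous_snd
    have hdisj : Disjoint (P A) (P Aᶜ) := by
      rw [Set.disjoint_left]
      rintro ⟨c, y⟩ ⟨v, hv, s, hs, h1⟩ ⟨w, hw, t, ht, h2⟩
      simp only at h1 h2
      exact hw ((OpenCone.mk_inj hs (h1.symm.trans h2)).1 ▸ hv)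
    have hsub : W \ {z : B × OpenCone L | z.2 = OpenCone.vertex} ⊆ P A ∪ P Aᶜ := by
      rintro ⟨c, y⟩ ⟨-, hy⟩
      rcases y.eq_vertex_or with h | ⟨v, s, hs, h⟩
      · exact absurd h hy
      · by_cases hv : v ∈ A
        · exact Or.inl ⟨v, hv, s, hs, h⟩
        · exact Or.inr ⟨v, hv, s, hs, h⟩
    have hin : ∀ v : L, ∃ s : Ico (0 : ℝ) 1, (0 : ℝ) < s ∧
        (b, OpenCone.mk v s) ∈ W \ {z : B × OpenCone L | z.2 = OpenCone.vertex} := by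
      intro v
      obtain ⟨s, hs, hm⟩ := hW' v
      exact ⟨s, hs, hm, fun h => hs.ne' ((OpenCone.mk_eq_vertex_iff v s).1 h)⟩
    have hmem : ∀ (A : Set L) (v : L), v ∈ A → ∀ s : Ico (0 : ℝ) 1, (0 : ℝ) < s →
        (b, OpenCone.mk v s) ∈ P A := fun A v hv s hs => ⟨v, hv, s, hs, rfl⟩
    rcases hWc.subset_or_subset (hopen A hA.isOpen) (hopen Aᶜ hA.compl.isOpen) hdisj hsub with h | h
    · obtain ⟨s, hs, hm⟩ := hin a'
      exact Set.disjoint_left.1 hdisj (h hm) (hmem _ a' ha' s hs)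
    · obtain ⟨s, hs, hm⟩ := hin a
      exact Set.disjoint_left.1 hdisj (hmem _ a ha s hs) (h hm)
  · intro hL V hV
    obtain ⟨V₁, hV₁, V₂, hV₂, hV12⟩ := mem_nhds_prod_iff.1 hV
    obtain ⟨B₁, hB₁, hB₁c, hB₁V⟩ := locallyConnectedSpace_iff_connected_subsets.1 ‹_› b V₁ hV₁
    obtain ⟨ε, hε, hεV⟩ := OpenCone.exists_radial_lt_subset hV₂
    set C : Set (OpenCone L) := {y | OpenCone.radial (fun _ => (1 : ℝ)) y < ε} with hC
    have hCo : IsOpen C := isOpen_lt (OpenCone.continuous_radial continuous_const) continuous_const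
    refine ⟨B₁ ×ˢ C, prod_mem_nhds hB₁ (hCo.mem_nhds (by simpa [hC] using hε)),
      (prod_mono hB₁V hεV).trans hV12, ?_⟩
    have hI : IsPreconnected {s : Ico (0 : ℝ) 1 | 0 < (s : ℝ) ∧ (s : ℝ) < ε} := by
      have : OrdConnected {s : Ico (0 : ℝ) 1 | 0 < (s : ℝ) ∧ (s : ℝ) < ε} :=
        ⟨fun x hx y hy z hz => ⟨hx.1.trans_le hz.1, lt_of_le_of_lt hz.2 hy.2⟩⟩
      rw [Topology.IsInducing.subtypeVal.isPreconnected_image.symm]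
      apply OrdConnected.isPreconnected
      refine ⟨?_⟩
      rintro _ ⟨x, hx, rfl⟩ _ ⟨y, hy, rfl⟩ z hz
      exact ⟨⟨z, x.2.1.trans hz.1, lt_of_le_of_lt hz.2 y.2.2⟩,
        ⟨hx.1.trans_le hz.1, lt_of_le_of_lt hz.2 hy.2⟩, rfl⟩
    have hcont : Continuous fun p : B × (L × Ico (0 : ℝ) 1) => (p.1, OpenCone.mk p.2.1 p.2.2) :=
      continuous_fst.prodMk (OpenCone.continuous_mk.comp continuous_snd)
    convert (hB₁c.prod (isPreconnected_univ (α := L) |>.prod hI)).image _ hcont.continuousOn using 1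
    ext ⟨c, y⟩
    constructor
    · rintro ⟨⟨hc, hy⟩, hne⟩
      rcases y.eq_vertex_or with h | ⟨v, s, hs, rfl⟩
      · exact absurd h hne
      · exact ⟨(c, v, s), ⟨hc, mem_univ v, hs, by simpa [hC] using hy⟩, rfl⟩
    · rintro ⟨⟨c', v, s⟩, ⟨hc, -, hs, hsε⟩, h⟩
      simp only [Prod.mk.injEq] at h
      obtain ⟨rfl, rfl⟩ := h
      refine ⟨⟨hc, by simpa [hC] using hsε⟩, fun h => hs.ne' ?_⟩
      exact (OpenCone.mk_eq_vertex_iff v s).1 h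

/-! ### Euclidean charts -/

theorem HasEuclideanChart.of_openPartialHomeomorph {F : Type*} [NormedAddCommGroup F]
    [NormedSpace ℝ F] [FiniteDimensional ℝ F] {k : ℕ} (hk : Module.finrank ℝ F = k) {X : Type*}
    [TopologicalSpace X] {x : X} (e : OpenPartialHomeomorph X F) (hx : x ∈ e.source) :
    HasEuclideanChart k x :=
  ⟨e.transHomeomorph (ContinuousLinearEquiv.ofFinrankEq (𝕜 := ℝ) (by simpa using hk)).toHomeomorph,
    by simpa using hx⟩

theorem hasEuclideanChart_of_finrank {F : Type*} [NormedAddCommGroup F]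
    [NormedSpace ℝ F] [FiniteDimensional ℝ F] {k : ℕ} (hk : Module.finrank ℝ F = k) (x : F) :
    HasEuclideanChart k x :=
  .of_openPartialHomeomorph hk (OpenPartialHomeomorph.refl F) (mem_univ x)

theorem HasEuclideanChart.of_comp {k : ℕ} {X Y : Type*} [TopologicalSpace X] [TopologicalSpace Y]
    {x : X} (e : OpenPartialHomeomorph X Y) (hx : x ∈ e.source) (h : HasEuclideanChart k (e x)) :
    HasEuclideanChart k x := by
  obtain ⟨f, hf⟩ := h
  exact ⟨e.trans f, by simp [hx, hf]⟩

theorem Topology.IsOpenEmbedding.hasEuclideanChart_iff {k : ℕ} {X Y : Type*} [TopologicalSpace X]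
    [TopologicalSpace Y] {i : Y → X} (hi : IsOpenEmbedding i) (y : Y) :
    HasEuclideanChart k (i y) ↔ HasEuclideanChart k y := by
  have : Nonempty Y := ⟨y⟩
  set e := hi.toOpenPartialHomeomorph
  have hy : y ∈ e.source := by simp [e]
  have hey : e y = i y := rfl
  constructor
  · exact fun h => .of_comp e hy h
  · intro h
    rw [← hey]
    refine .of_comp e.symm (e.map_source hy) ?_
    rwa [e.left_inv hy]

theorem HasEuclideanChart.prodMk {k k' : ℕ} {X Y : Type*} [TopologicalSpace X]
    [TopologicalSpace Y] {x : X} {y : Y} (hx : HasEuclideanChart k x)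
    (hy : HasEuclideanChart k' y) : HasEuclideanChart (k + k') (x, y) := by
  obtain ⟨e, he⟩ := hx
  obtain ⟨f, hf⟩ := hy
  exact .of_openPartialHomeomorph (by simp) (e.prod f) ⟨he, hf⟩

theorem hasEuclideanChart_zero_of_discrete {X : Type*} [TopologicalSpace X] [DiscreteTopology X]
    (x : X) : HasEuclideanChart 0 x := by
  have hi : IsOpenEmbedding (fun _ : Unit => x) :=
    .of_continuous_injective_isOpenMap continuous_const
      (fun _ _ _ => rfl) fun s _ => isOpen_discrete _
  have hj : IsOpenEmbedding (fun _ : Unit => (0 : EuclideanSpace ℝ (Fin 0))) :=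
    .of_continuous_injective_isOpenMap continuous_const
      (fun _ _ _ => rfl) fun s _ => isOpen_discrete _
  exact (hi.hasEuclideanChart_iff ()).2 ((hj.hasEuclideanChart_iff ()).1
    (hasEuclideanChart_of_finrank (by simp) _))

theorem hasEuclideanChart_torus {m : ℕ} (t : Torus m) : HasEuclideanChart m t := by
  refine .of_openPartialHomeomorph (F := Fin m → EuclideanSpace ℝ (Fin 1))
    (by rw [Module.finrank_pi_fintype]; simp)
    (OpenPartialHomeomorph.pi fun a => chartAt (EuclideanSpace ℝ (Fin 1)) (t a)) ?_
  intro a _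
  exact mem_chart_source _ _

theorem hasEuclideanChart_of_isOpen {k : ℕ} {O : Set (EuclideanSpace ℝ (Fin k))} (hO : IsOpen O)
    (x : O) : HasEuclideanChart k x :=
  (hO.isOpenEmbedding_subtypeVal.hasEuclideanChart_iff x).1
    (hasEuclideanChart_of_finrank (by simp) _)

theorem locallyConnectedSpace_of_hasEuclideanChart {k : ℕ} {X : Type*} [TopologicalSpace X]
    (h : ∀ x : X, HasEuclideanChart k x) : LocallyConnectedSpace X := by
  choose e he using h
  let _ : ChartedSpace (EuclideanSpace ℝ (Fin k)) X :=
    { atlas := range e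
      chartAt := e
      mem_chart_source := he
      chart_mem_atlas := fun x => mem_range_self x }
  exact ChartedSpace.locallyConnectedSpace (EuclideanSpace ℝ (Fin k)) X

theorem isManifoldOfDim_of_hasEuclideanChart {k : ℕ} {X : Type u} [TopologicalSpace X] [T2Space X]
    [SecondCountableTopology X] (h : ∀ x : X, HasEuclideanChart k x) : IsManifoldOfDim k X := by
  refine ⟨inferInstance, inferInstance, ?_⟩
  choose e he using h
  exact ⟨{ atlas := range e
           chartAt := e
           mem_chart_source := he
           chart_mem_atlas := fun x => mem_range_self x }⟩

theorem IsManifoldOfDim.hasEuclideanChart {k : ℕ} {X : Type u} [TopologicalSpace X]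
    (h : IsManifoldOfDim k X) (x : X) : HasEuclideanChart k x := by
  obtain ⟨-, -, ⟨c⟩⟩ := h
  exact ⟨chartAt _ x, mem_chart_source _ x⟩

/-- The components of a locally Euclidean subspace are manifolds. -/
theorem isManifoldOfDim_connectedComponentIn {k : ℕ} {X : Type u} [TopologicalSpace X] [T2Space X]
    [SecondCountableTopology X] {A : Set X} (h : ∀ x : A, HasEuclideanChart k x) (p : X)
    (hp : p ∈ A) : IsManifoldOfDim k (connectedComponentIn A p) := by
  have : LocallyConnectedSpace A := locallyConnectedSpace_of_hasEuclideanChart h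
  refine isManifoldOfDim_of_hasEuclideanChart fun y => ?_
  set C : Set A := connectedComponent ⟨p, hp⟩
  have hC : connectedComponentIn A p = (Subtype.val : A → X) '' C := connectedComponentIn_eq_image hp
  let j : connectedComponentIn A p → A := Set.inclusion (connectedComponentIn_subset A p)
  have hj : IsOpenEmbedding j := by
    refine ⟨IsEmbedding.of_comp (continuous_inclusion _) continuous_subtype_val
      IsEmbedding.subtypeVal, ?_⟩
    convert (isOpen_connectedComponent : IsOpen C) using 1
    ext z
    simp only [j, mem_range]
    constructor
    · rintro ⟨w, rfl⟩
      obtain ⟨c, hc, hcw⟩ := hC.subset w.2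
      rwa [show Set.inclusion _ w = c from Subtype.ext hcw.symm]
    · intro hz
      exact ⟨⟨z, hC.superset (mem_image_of_mem _ hz)⟩, rfl⟩
  exact (hj.hasEuclideanChart_iff y).1 (h (j y))

/-! ### Cones and manifolds -/

theorem Topology.IsOpenEmbedding.hasLocalRetract {E : Type*} [NormedAddCommGroup E] {X Y : Type*}
    [TopologicalSpace X] [TopologicalSpace Y] {i : Y → X} (hi : IsOpenEmbedding i) {y : Y}
    (h : HasLocalRetract E y) : HasLocalRetract E (i y) := by
  have : Nonempty Y := ⟨y⟩
  obtain ⟨U, hU, hy, g, hg, hg0, σ, ε, hε, hσ, hσU, hgσ⟩ := h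
  set e := hi.toOpenPartialHomeomorph
  have hinv : ∀ z, e.symm (i z) = z := fun z => e.left_inv (x := z) (by simp [e])
  refine ⟨i '' U, hi.isOpenMap _ hU, mem_image_of_mem i hy, g ∘ e.symm, ?_, ?_, i ∘ σ, ε, hε,
    hi.continuous.comp_continuousOn hσ, fun z hz => mem_image_of_mem i (hσU hz), ?_⟩
  · refine hg.comp (e.continuousOn_symm.mono ?_) ?_
    · rintro _ ⟨z, -, rfl⟩
      simp [e]
    · rintro _ ⟨z, hz, rfl⟩
      rwa [hinv]
  · rintro _ ⟨z, hz, rfl⟩ h0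
    rw [Function.comp_apply, hinv] at h0
    rw [hg0 z hz h0]
  · intro z hz
    simp only [Function.comp_apply, hinv]
    exact hgσ z hz

/-- If `L` is disconnected, the product of `ℝ^d` and the cone on `L` retracts locally to the
product of `ℝ^d` and a line through the vertex. -/
theorem hasLocalRetract_vertex {d : ℕ} {B : Type*} {L : Type u} [TopologicalSpace B]
    [TopologicalSpace L] {b : B} (hb : HasEuclideanChart d b) (hL : ¬ PreconnectedSpace L) :
    HasLocalRetract (EuclideanSpace ℝ (Fin d) × ℝ) (b, (OpenCone.vertex : OpenCone L)) := by
  classical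
  obtain ⟨e, he⟩ := hb
  rw [preconnectedSpace_iff_clopen] at hL
  push Not at hL
  obtain ⟨A, hA, ⟨a, ha⟩, hA1⟩ := hL
  obtain ⟨a', ha'⟩ := (ne_univ_iff_exists_notMem A).1 hA1
  -- The sign separates the two clopen parts of `L`, so `radial f` is a signed distance from the
  -- vertex.
  set f : L → ℝ := fun v => if v ∈ A then 1 else -1 with hf
  have hfc : Continuous f := continuous_if (by simp [hA.frontier_eq]) continuousOn_const
    continuousOn_const
  have hf0 : ∀ v, f v ≠ 0 := fun v => by
    by_cases h : v ∈ A <;> simp [hf, h]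
  have hmin : ∀ s : ℝ, min |s| (1 / 2) ∈ Ico (0 : ℝ) 1 := fun s =>
    ⟨by positivity, (min_le_right _ _).trans_lt (by norm_num)⟩
  -- The line through the vertex: the ray over `a` for `s ≥ 0`, the ray over `a'` for `s < 0`. The
  -- cap `1 / 2` keeps the height below `1` and has no effect for `|s| < 1 / 2`.
  set c : ℝ → OpenCone L := fun s =>
    if 0 ≤ s then OpenCone.mk a ⟨_, hmin s⟩ else OpenCone.mk a' ⟨_, hmin s⟩ with hc
  have hcc : Continuous c := by
    have hmk : ∀ v : L, Continuous fun s : ℝ => OpenCone.mk v ⟨_, hmin s⟩ := fun v =>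
      OpenCone.continuous_mk.comp (by fun_prop : Continuous fun s : ℝ =>
        (v, (⟨_, hmin s⟩ : Ico (0 : ℝ) 1)))
    refine Continuous.if_le (hmk a) (hmk a') continuous_const continuous_id ?_
    rintro s rfl
    rw [(OpenCone.mk_eq_vertex_iff a _).2 (by simp), (OpenCone.mk_eq_vertex_iff a' _).2 (by simp)]
  have hcs : ∀ s : ℝ, |s| < 1 / 2 → OpenCone.radial f (c s) = s := by
    intro s hs
    by_cases h : 0 ≤ s
    · simp only [hc, h, if_true, OpenCone.radial_mk, min_eq_left hs.le]
      simp [hf, ha, abs_of_nonneg h]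
    · simp only [hc, h, if_false, OpenCone.radial_mk, min_eq_left hs.le]
      simp [hf, ha', abs_of_neg (not_le.1 h)]
  obtain ⟨r, hr, hrs⟩ := Metric.isOpen_iff.1 e.open_target _ (e.map_source he)
  have hmem : ∀ z ∈ Metric.ball (0 : EuclideanSpace ℝ (Fin d) × ℝ) (min r (1 / 2)),
      z.1 + e b ∈ e.target ∧ |z.2| < 1 / 2 := by
    intro z hz
    rw [mem_ball_zero_iff, lt_min_iff, Prod.norm_def] at hz
    refine ⟨hrs ?_, ((le_max_right _ _).trans_lt hz.2)⟩
    simpa [dist_eq_norm] using (le_max_left _ _).trans_lt hz.1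
  refine ⟨e.source ×ˢ univ, e.open_source.prod isOpen_univ, ⟨he, mem_univ _⟩,
    fun y => (e y.1 - e b, OpenCone.radial f y.2), ?_, ?_,
    fun z => (e.symm (z.1 + e b), c z.2), min r (1 / 2), by positivity, ?_, ?_, ?_⟩
  · refine ContinuousOn.prodMk ?_ ?_
    · exact (e.continuousOn.comp continuous_fst.continuousOn fun y hy => hy.1).sub
        continuousOn_const
    · exact ((OpenCone.continuous_radial hfc).comp continuous_snd).continuousOn
  · rintro ⟨y, w⟩ ⟨hy, -⟩ h0
    simp only [Prod.mk_eq_zero] at h0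
    exact Prod.ext (e.injOn hy he (sub_eq_zero.1 h0.1))
      ((OpenCone.radial_eq_zero_iff f hf0 w).1 h0.2)
  · refine ContinuousOn.prodMk ?_ (hcc.comp continuous_snd).continuousOn
    exact e.continuousOn_symm.comp (by fun_prop) fun z hz => (hmem z hz).1
  · exact fun z hz => ⟨e.map_target (hmem z hz).1, mem_univ _⟩
  · intro z hz
    simp only [e.right_inv (hmem z hz).1, hcs _ (hmem z hz).2]
    simp

/-- The open cone on a circle is an open disc. -/
theorem hasEuclideanChart_cone_circle {L : Type u} [TopologicalSpace L] (f : L ≃ₜ Circle)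
    (y : OpenCone L) : HasEuclideanChart 2 y := by
  have : CompactSpace L := f.symm.compactSpace
  set h : OpenCone L → ℂ := OpenCone.radial fun v => (f v : ℂ) with hh
  have hc : Continuous h := OpenCone.continuous_radial (by fun_prop)
  have hf1 : ∀ v, ‖(f v : ℂ)‖ = 1 := fun v => Circle.norm_coe (f v)
  have hnorm : ∀ y, ‖h y‖ = OpenCone.radial (fun _ => (1 : ℝ)) y := by
    intro y
    rcases y.eq_vertex_or with rfl | ⟨v, s, hs, rfl⟩
    · simp [hh]
    · simp [hh, hf1, abs_of_pos hs]
  have hlt : ∀ y, ‖h y‖ < 1 := by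
    intro y
    rcases y.eq_vertex_or with rfl | ⟨v, s, hs, rfl⟩
    · simp [hh]
    · simpa [hh, hf1, abs_of_pos hs] using s.2.2
  -- The value `1` at `w = 0` is arbitrary: it is used only at height zero, where all directions are
  -- collapsed to the vertex.
  set c : ℂ → Circle := fun w => if hw : w = 0 then 1 else
    ⟨w / ‖w‖, by simp [Submonoid.unitSphere, hw]⟩ with hcd
  have hcv : ∀ w : ℂ, w ≠ 0 → (c w : ℂ) = w / ‖w‖ := fun w hw => by simp [hcd, hw]
  have hccont : ∀ w : ℂ, w ≠ 0 → ContinuousAt c w := by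
    intro w hw
    have hi : IsInducing (fun z : Circle => (z : ℂ)) := ⟨rfl⟩
    rw [hi.continuousAt_iff]
    have : ContinuousAt (fun w : ℂ => w / ‖w‖) w :=
      continuousAt_id.div (by fun_prop) (by simpa using hw)
    refine this.congr ?_
    filter_upwards [isOpen_ne.mem_nhds hw] with z hz
    exact (hcv z hz).symm
  set g : Metric.ball (0 : ℂ) 1 → OpenCone L := fun w =>
    OpenCone.mk (f.symm (c w)) ⟨‖(w : ℂ)‖, norm_nonneg _, mem_ball_zero_iff.1 w.2⟩ with hg
  have hgh : ∀ y, g ⟨h y, by simpa using hlt y⟩ = y := by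
    intro y
    rcases y.eq_vertex_or with rfl | ⟨v, s, hs, rfl⟩
    · simp [hg, hh, OpenCone.mk_eq_vertex_iff]
    · have hne : h (OpenCone.mk v s) ≠ 0 := by simp [hh, hs.ne']
      have h1 : ‖h (OpenCone.mk v s)‖ = s := by simp [hh, hf1, abs_of_pos hs]
      have h2 : c (h (OpenCone.mk v s)) = f v := by
        apply Circle.coe_injective
        rw [hcv _ hne, h1]
        have : (s : ℂ) ≠ 0 := by exact_mod_cast hs.ne'
        simp [hh, this]
      simp only [hg, h1, h2, f.symm_apply_apply]
  have hhg : ∀ w : Metric.ball (0 : ℂ) 1, h (g w) = w := by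
    intro w
    simp only [hg, hh, OpenCone.radial_mk, f.apply_symm_apply]
    by_cases hw : (w : ℂ) = 0
    · simp [hw]
    · have : ((‖(w : ℂ)‖ : ℝ) : ℂ) ≠ 0 := by simpa using hw
      rw [hcv _ hw, Complex.real_smul, mul_div_cancel₀ _ this]
  have hgc : Continuous g := by
    rw [continuous_iff_continuousAt]
    intro w
    -- The direction is discontinuous at the centre; continuity there comes from the neighbourhood
    -- basis of the vertex by height, hence from compactness of `L`.
    by_cases hw : (w : ℂ) = 0
    · have hgw : g w = OpenCone.vertex := (OpenCone.mk_eq_vertex_iff _ _).2 (by simpa using hw)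
      intro W hW
      rw [hgw] at hW
      obtain ⟨ε, hε, hεW⟩ := OpenCone.exists_radial_lt_subset hW
      have : {z : Metric.ball (0 : ℂ) 1 | ‖(z : ℂ)‖ < ε} ∈ 𝓝 w :=
        (isOpen_lt (by fun_prop) continuous_const).mem_nhds (by simpa [hw] using hε)
      refine Filter.mem_map.2 (Filter.mem_of_superset this fun z hz => hεW _ ?_)
      rw [← hnorm, hhg]
      exact hz
    · have h1 : ContinuousAt (fun w : Metric.ball (0 : ℂ) 1 => f.symm (c w)) w :=
        f.symm.continuous.continuousAt.comp
          (ContinuousAt.comp (f := fun w : Metric.ball (0 : ℂ) 1 => (w : ℂ)) (hccont _ hw)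
            continuous_subtype_val.continuousAt)
      have h2 : Continuous (fun w : Metric.ball (0 : ℂ) 1 =>
        (⟨‖(w : ℂ)‖, norm_nonneg _, mem_ball_zero_iff.1 w.2⟩ : Ico (0 : ℝ) 1)) := by fun_prop
      exact ContinuousAt.comp (g := fun p : L × Ico (0 : ℝ) 1 => OpenCone.mk p.1 p.2)
        OpenCone.continuous_mk.continuousAt (h1.prodMk h2.continuousAt)
  let φ : OpenCone L ≃ₜ Metric.ball (0 : ℂ) 1 :=
    { toFun := fun y => ⟨h y, by simpa using hlt y⟩
      invFun := g
      left_inv := hgh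
      right_inv := fun w => Subtype.ext (hhg w)
      continuous_toFun := hc.subtype_mk fun y => by simpa using hlt y
      continuous_invFun := hgc }
  have hi : IsOpenEmbedding (fun y => (φ y : ℂ)) :=
    Metric.isOpen_ball.isOpenEmbedding_subtypeVal.comp φ.isOpenEmbedding
  exact (hi.hasEuclideanChart_iff y).1
    (hasEuclideanChart_of_finrank Complex.finrank_real_complex _)

/-! ### Links of stratified pseudomanifolds -/

section

variable {X Z : Type*} [TopologicalSpace X] [TopologicalSpace Z] {U : Set X}

theorem IsOpen.isOpenEmbedding_coe_symm (hU : IsOpen U) (φ : U ≃ₜ Z) :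
    IsOpenEmbedding fun z => (φ.symm z : X) :=
  hU.isOpenEmbedding_subtypeVal.comp φ.symm.isOpenEmbedding

end

/-- The chart condition for `j = -1`, with `G (-1) = ∅`, says that `F k` corresponds to `O ×
{vertex}`. The left side does not involve `L`, so all compact links at `p` are connected or none is.
-/
theorem HasLinkChart.locallyPreconnectedCompl_iff {Q : Type u} [TopologicalSpace Q]
    {F : ℤ → Set Q} {k c : ℕ} {p : Q} (hp : p ∈ F k) {L : Type u} [TopologicalSpace L]
    [CompactSpace L] {G : ℤ → Set L} (h : HasLinkChart F k c p L G) :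
    LocallyPreconnectedCompl (F k) p ↔ PreconnectedSpace L := by
  obtain ⟨U, hU, hpU, O, hO, -, φ, hG, hφ⟩ := h
  have hv : ∀ y : U, (y : Q) ∈ F k ↔ (φ y).2 = OpenCone.vertex := by
    intro y
    have := hφ (-1) le_rfl (by omega) y
    rwa [hG, OpenCone.mem_sub_empty, show (k : ℤ) + -1 + 1 = k by ring] at this
  have : LocallyConnectedSpace O := hO.isOpenEmbedding_subtypeVal.locallyConnectedSpace
  have hi := hU.isOpenEmbedding_coe_symm φ
  have hpe : p = (φ.symm ((φ ⟨p, hpU⟩).1, OpenCone.vertex) : Q) := by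
    rw [← (hv ⟨p, hpU⟩).1 hp]
    simp
  have hpre : (fun z => (φ.symm z : Q)) ⁻¹' F k = {z : O × OpenCone L | z.2 = OpenCone.vertex} := by
    ext z
    rw [mem_preimage, hv]
    simp
  rw [← locallyPreconnectedCompl_vertex_iff (φ ⟨p, hpU⟩).1, ← hpre]
  conv_lhs => rw [hpe]
  exact hi.locallyPreconnectedCompl_iff _ _

/-- A point whose link is empty has a Euclidean chart. -/
theorem HasLinkChart.hasEuclideanChart {Q : Type u} [TopologicalSpace Q]
    {F : ℤ → Set Q} {k c : ℕ} {p : Q} {L : Type u} [TopologicalSpace L] [IsEmpty L]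
    {G : ℤ → Set L} (h : HasLinkChart F k c p L G) : HasEuclideanChart k p := by
  obtain ⟨U, hU, hpU, O, hO, -, φ, -⟩ := h
  have hi := hU.isOpenEmbedding_coe_symm φ
  have hpe : p = (φ.symm (φ ⟨p, hpU⟩) : Q) := by simp
  rw [hpe]
  refine (hi.hasEuclideanChart_iff _).2 ?_
  have : DiscreteTopology (OpenCone L) := by
    have : Subsingleton (OpenCone L) :=
      ⟨fun a b => by rw [a.eq_vertex_of_isEmpty, b.eq_vertex_of_isEmpty]⟩
    infer_instance
  exact (hasEuclideanChart_of_isOpen hO _).prodMk (hasEuclideanChart_zero_of_discrete _)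

/-- The points of a stratum over which the cone structure is a product with the vertex form a
locally Euclidean space. -/
theorem HasLinkChart.hasEuclideanChart_stratum {Q : Type u} [TopologicalSpace Q]
    {F : ℤ → Set Q} {k c : ℕ} (p : F k) {L : Type u} [TopologicalSpace L]
    {G : ℤ → Set L} (h : HasLinkChart F k c (p : Q) L G) : HasEuclideanChart k p := by
  obtain ⟨U, hU, hpU, O, hO, -, φ, hG, hφ⟩ := h
  have hv : ∀ y : U, (y : Q) ∈ F k ↔ (φ y).2 = OpenCone.vertex := by
    intro y
    have := hφ (-1) le_rfl (by omega) y
    rwa [hG, OpenCone.mem_sub_empty, show (k : ℤ) + -1 + 1 = k by ring] at this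
  have hi := hU.isOpenEmbedding_coe_symm φ
  have hc : Continuous fun o : O => (φ.symm (o, OpenCone.vertex) : Q) :=
    hi.continuous.comp (Continuous.prodMk_left _)
  let j : O → F k := fun o => ⟨φ.symm (o, OpenCone.vertex), (hv _).2 (by simp)⟩
  have hj : IsOpenEmbedding j := by
    refine .of_continuous_injective_isOpenMap (hc.subtype_mk _) ?_ ?_
    · intro o o' h
      have h' : (φ.symm (o, OpenCone.vertex) : Q) = φ.symm (o', OpenCone.vertex) :=
        congrArg (fun q : F k => (q : Q)) h
      exact (Prod.ext_iff.1 (hi.injective h')).1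
    · intro W hW
      have h1 := hi.isOpenMap _ (hW.prod (isOpen_univ (X := OpenCone L)))
      convert h1.preimage (continuous_subtype_val (p := fun q => q ∈ F k)) using 1
      ext q
      constructor
      · rintro ⟨o, ho, rfl⟩
        exact ⟨(o, OpenCone.vertex), ⟨ho, mem_univ _⟩, rfl⟩
      · rintro ⟨⟨o, y⟩, ⟨ho, -⟩, hq⟩
        refine ⟨o, ho, Subtype.ext ?_⟩
        have hm : ((φ.symm (o, y) : U) : Q) ∈ F k := by
          simp only at hq
          rw [hq]
          exact q.2
        have hy : y = OpenCone.vertex := by simpa using (hv _).1 hm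
        rw [← hq, hy]
  have hpj : p = j (φ ⟨p, hpU⟩).1 := by
    apply Subtype.ext
    simp only [j]
    rw [← (hv ⟨p, hpU⟩).1 p.2]
    simp
  rw [hpj]
  exact (hj.hasEuclideanChart_iff _).2 (hasEuclideanChart_of_isOpen hO _)

/-- A point with a Euclidean chart, all of whose neighbours lie in the skeleton of its dimension,
has the empty link. -/
theorem HasEuclideanChart.hasLinkChart {Q : Type u} [TopologicalSpace Q] {F : ℤ → Set Q} {k : ℕ}
    {p : Q} (h : HasEuclideanChart k p) (hF : F k = univ) :
    HasLinkChart F k 0 p PEmpty.{u + 1} fun _ => ∅ := by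
  obtain ⟨e, he⟩ := h
  obtain ⟨r, hr, hrs⟩ := Metric.isOpen_iff.1 e.open_target _ (e.map_source he)
  have hcon : ContractibleSpace (Metric.ball (e p) r) :=
    (convex_ball (e p) r).contractibleSpace ⟨_, Metric.mem_ball_self hr⟩
  have hsub : e.source ∩ e ⁻¹' Metric.ball (e p) r ⊆ e.source := inter_subset_left
  have himg : e '' (e.source ∩ e ⁻¹' Metric.ball (e p) r) = Metric.ball (e p) r := by
    rw [e.image_source_inter_eq', ← preimage_comp]
    ext z
    constructor
    · rintro ⟨hz, hz'⟩
      simpa [e.right_inv hz] using hz'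
    · intro hz
      exact ⟨hrs hz, by simpa [e.right_inv (hrs hz)] using hz⟩
  have : Unique (OpenCone PEmpty.{u + 1}) :=
    ⟨⟨OpenCone.vertex⟩, fun a => a.eq_vertex_of_isEmpty⟩
  refine ⟨e.source ∩ e ⁻¹' Metric.ball (e p) r, e.isOpen_inter_preimage Metric.isOpen_ball,
    ⟨he, Metric.mem_ball_self hr⟩, Metric.ball (e p) r, Metric.isOpen_ball, hcon,
    ((e.homeomorphOfImageSubsetSource hsub himg).trans (Homeomorph.prodUnique _ _).symm), rfl, ?_⟩
  intro j hj hj' y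
  -- In codimension zero the range `-1 ≤ j ≤ c - 1` leaves this one index.
  obtain rfl : j = -1 := by
    have : ((0 : ℕ) : ℤ) = 0 := rfl
    omega
  rw [show (k : ℤ) + -1 + 1 = k by ring, hF]
  exact iff_of_true (mem_univ _) (Or.inl (OpenCone.eq_vertex_of_isEmpty _))

/-- A nonempty finite discrete space is a zero-dimensional stratified pseudomanifold. -/
theorem isStratPseudomanifold_discrete (L : Type u) [TopologicalSpace L] [DiscreteTopology L]
    [Nonempty L] : IsStratPseudomanifold 0 0 L fun j : ℤ => if 0 ≤ j then univ else ∅ := by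
  rw [IsStratPseudomanifold]
  refine ⟨⟨inferInstance, fun j => isClosed_discrete _, ?_, by simp, by simp [empty_ne_univ], by simp,
    by simp⟩, fun _ => inferInstance, fun h => absurd rfl h⟩
  intro i j hij
  by_cases hi : 0 ≤ i
  · simp [hi, hi.trans hij]
  · simp [hi]

/-! ### Equivariant charts -/

/-- The data of an equivariant chart, see `HasTorusChart`. -/
structure TorusChart (l m n i : ℕ) {X : Type u} [TopologicalSpace X] [MulAction (Torus m) X]
    (x : X) (L : Type u) [TopologicalSpace L] [MulAction (Torus (n - i)) L] where
  U : Set X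
  isOpen_U : IsOpen U
  mem_U : x ∈ U
  smul_mem : ∀ (t : Torus m), ∀ y ∈ U, t • y ∈ U
  O : Set (EuclideanSpace ℝ (Fin l))
  isOpen_O : IsOpen O
  contractible_O : ContractibleSpace O
  Ω : Set (Fin i → ℂˣ)
  isOpen_Ω : IsOpen Ω
  ψ : Torus m ≃ₜ* (Torus i × Torus (m - n)) × Torus (n - i)
  mem_stabilizer : ∀ t : Torus m, t ∈ MulAction.stabilizer (Torus m) x ↔ (ψ t).1 = 1
  φ : U ≃ₜ O × (Ω × Torus (m - n)) × OpenCone L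
  map_smul_O : ∀ (t : Torus m) (y : U), (φ ⟨t • (y : X), smul_mem t y y.2⟩).1 = (φ y).1
  map_smul_Ω : ∀ (t : Torus m) (y : U),
    ((φ ⟨t • (y : X), smul_mem t y y.2⟩).2.1.1 : Fin i → ℂˣ) =
      torusMul (ψ t).1.1 ((φ y).2.1.1 : Fin i → ℂˣ)
  map_smul_torus : ∀ (t : Torus m) (y : U),
    (φ ⟨t • (y : X), smul_mem t y y.2⟩).2.1.2 = (ψ t).1.2 * (φ y).2.1.2
  map_smul_cone : ∀ (t : Torus m) (y : U),
    (φ ⟨t • (y : X), smul_mem t y y.2⟩).2.2 = OpenCone.map (fun v => (ψ t).2 • v) (φ y).2.2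

theorem HasTorusChart.nonempty {l m n i : ℕ} {X : Type u} [TopologicalSpace X]
    [MulAction (Torus m) X] {x : X} {L : Type u} [TopologicalSpace L]
    [MulAction (Torus (n - i)) L] (h : HasTorusChart l m n i x L) :
    Nonempty (TorusChart l m n i x L) := by
  obtain ⟨U, hUo, hxU, hU, O, hO, hOc, Ω, hΩ, -, ψ, hψ, φ, hφ⟩ := h
  exact ⟨⟨U, hUo, hxU, hU, O, hO, hOc, Ω, hΩ, ψ, hψ, φ, fun t y => (hφ t y).1,
    fun t y => (hφ t y).2.1, fun t y => (hφ t y).2.2.1, fun t y => (hφ t y).2.2.2⟩⟩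

theorem torusMul_eq_self_iff {i : ℕ} (t : Torus i) (w : Fin i → ℂˣ) :
    torusMul t w = w ↔ t = 1 := by
  constructor
  · intro h
    funext a
    have h1 : Circle.toUnits (t a) * w a = w a := congrFun h a
    have h2 : Circle.toUnits (t a) = 1 := by simpa using h1
    apply Circle.coe_injective
    simpa using congrArg Units.val h2
  · rintro rfl
    funext a
    simp [torusMul]

namespace TorusChart

variable {l m n i : ℕ} {X : Type u} [TopologicalSpace X] [MulAction (Torus m) X]
  {x : X} {L : Type u} [TopologicalSpace L] [MulAction (Torus (n - i)) L]
  (c : TorusChart l m n i x L)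

/-- Injectivity of `φ` turns the equivariance formulas into an equivalence. This is how orbits are
recognised as fibres of maps on the model. -/
theorem φ_smul_eq_iff (t : Torus m) (y z : c.U) :
    t • (y : X) = z ↔ (c.φ z).1 = (c.φ y).1 ∧
      ((c.φ z).2.1.1 : Fin i → ℂˣ) = torusMul (c.ψ t).1.1 ((c.φ y).2.1.1 : Fin i → ℂˣ) ∧
      (c.φ z).2.1.2 = (c.ψ t).1.2 * (c.φ y).2.1.2 ∧
      (c.φ z).2.2 = OpenCone.map (fun v => (c.ψ t).2 • v) (c.φ y).2.2 := by
  rw [← c.map_smul_O t y, ← c.map_smul_Ω t y, ← c.map_smul_torus t y, ← c.map_smul_cone t y]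
  constructor
  · intro h
    have : z = ⟨t • (y : X), c.smul_mem t y y.2⟩ := Subtype.ext h.symm
    rw [this]
    exact ⟨rfl, rfl, rfl, rfl⟩
  · rintro ⟨h1, h2, h3, h4⟩
    have : z = ⟨t • (y : X), c.smul_mem t y y.2⟩ :=
      c.φ.injective (Prod.ext h1 (Prod.ext (Prod.ext (Subtype.ext h2) h3) h4))
    exact (congrArg Subtype.val this).symm

/-- The action of the first factor on `Ω × U(1)^(m-n)` is free, so fixing `y` forces `(ψ t).1 = 1`,
which is the condition for fixing `x`; only the cone coordinate remains to be fixed. -/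
theorem mem_stabilizer_iff (t : Torus m) (y : c.U) :
    t ∈ MulAction.stabilizer (Torus m) (y : X) ↔ t ∈ MulAction.stabilizer (Torus m) x ∧
      OpenCone.map (fun v => (c.ψ t).2 • v) (c.φ y).2.2 = (c.φ y).2.2 := by
  rw [MulAction.mem_stabilizer_iff, c.φ_smul_eq_iff, c.mem_stabilizer]
  constructor
  · rintro ⟨-, h2, h3, h4⟩
    refine ⟨Prod.ext ((torusMul_eq_self_iff _ _).1 h2.symm) ?_, h4.symm⟩
    simpa using h3
  · rintro ⟨h, h4⟩
    rw [h]
    refine ⟨rfl, ((torusMul_eq_self_iff _ _).2 rfl).symm, by simp, h4.symm⟩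

theorem stabilizer_eq_of_vertex (y : c.U) (hy : (c.φ y).2.2 = OpenCone.vertex) :
    MulAction.stabilizer (Torus m) (y : X) = MulAction.stabilizer (Torus m) x := by
  ext t
  rw [c.mem_stabilizer_iff, hy]
  exact and_iff_left rfl

theorem stabilizer_eq_bot (hL : ∀ (t : Torus (n - i)) (v : L), t • v = v → t = 1) (y : c.U)
    (hy : (c.φ y).2.2 ≠ OpenCone.vertex) : MulAction.stabilizer (Torus m) (y : X) = ⊥ := by
  rw [eq_bot_iff]
  intro t ht
  obtain ⟨h1, h2⟩ := (c.mem_stabilizer_iff t y).1 ht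
  rcases (c.φ y).2.2.eq_vertex_or with h | ⟨v, s, hs, h⟩
  · exact absurd h hy
  · rw [h, OpenCone.map_mk] at h2
    have h3 := hL _ _ (OpenCone.mk_inj hs h2).1
    rw [Subgroup.mem_bot, ← c.ψ.map_eq_one_iff]
    exact Prod.ext ((c.mem_stabilizer t).1 h1) h3

end TorusChart

/-! ### The filtration by orbit dimension -/

/-- The points with nontrivial isotropy group. -/
def nonfreePoints (m : ℕ) (X : Type u) [MulAction (Torus m) X] : Set X :=
  {x | MulAction.stabilizer (Torus m) x ≠ ⊥}

section

variable {l m n : ℕ} {X : Type u} [MulAction (Torus m) X]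

theorem HasOrbitDim.le {x : X} {k : ℕ} (h : HasOrbitDim m x k) : k ≤ m := by
  obtain ⟨r, hr, -⟩ := h
  omega

theorem HasOrbitDim.mem_nonfreePoints_iff {x : X} {k : ℕ} (h : HasOrbitDim m x k) :
    x ∈ nonfreePoints m X ↔ k < m := by
  obtain ⟨r, hr, ⟨e⟩⟩ := h
  have h1 : x ∈ nonfreePoints m X ↔ Nontrivial (MulAction.stabilizer (Torus m) x) :=
    (Subgroup.nontrivial_iff_ne_bot _).symm
  rw [h1, e.toEquiv.nontrivial_congr]
  constructor
  · intro hr'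
    by_contra! hk
    obtain rfl : r = 0 := by omega
    exact false_of_nontrivial_of_subsingleton (Torus 0)
  · intro hk
    have : NeZero r := ⟨by omega⟩
    have : Nontrivial Circle := ⟨1, Circle.exp Real.pi, fun h => by
      have := congrArg (fun z : Circle => (z : ℂ).re) h
      norm_num [Circle.coe_exp] at this⟩
    exact Pi.nontrivial

/-- The torus is commutative, so isotropy groups are constant along orbits. -/
theorem stabilizer_smul_eq (t : Torus m) (x : X) :
    MulAction.stabilizer (Torus m) (t • x) = MulAction.stabilizer (Torus m) x := by
  ext s
  rw [MulAction.mem_stabilizer_iff, MulAction.mem_stabilizer_iff, smul_comm, smul_left_cancel_iff]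

theorem hasOrbitDim_smul_iff (t : Torus m) (x : X) (k : ℕ) :
    HasOrbitDim m (t • x) k ↔ HasOrbitDim m x k := by
  rw [HasOrbitDim, HasOrbitDim, stabilizer_smul_eq]

theorem smul_mem_orbitFiltration_iff (t : Torus m) (x : X) (j : ℤ) :
    t • x ∈ orbitFiltration l m n X j ↔ x ∈ orbitFiltration l m n X j :=
  exists_congr fun k => and_congr_left fun _ => hasOrbitDim_smul_iff t x k

/-- The class of `x` in the orbit space. -/
noncomputable def orbitMk (m : ℕ) {X : Type u} [MulAction (Torus m) X] (x : X) : OrbitSpace m X :=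
  Quotient.mk (MulAction.orbitRel (Torus m) X) x

theorem orbitMk_surjective : Function.Surjective (orbitMk m : X → OrbitSpace m X) :=
  Quotient.mk_surjective

theorem orbitMk_eq_iff {x y : X} : orbitMk m x = orbitMk m y ↔ ∃ t : Torus m, t • x = y := by
  rw [eq_comm]
  exact Quotient.eq.trans MulAction.orbitRel_apply

theorem orbitMk_mem_orbitSpaceFiltration_iff (x : X) (j : ℤ) :
    orbitMk m x ∈ orbitSpaceFiltration l m n X j ↔
      x ∈ orbitFiltration l m n X (l + 2 * (j - l) + (m - n)) := by
  constructor
  · rintro ⟨y, hy, hyx⟩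
    obtain ⟨t, rfl⟩ := orbitMk_eq_iff.1 hyx
    exact (smul_mem_orbitFiltration_iff t y _).2 hy
  · exact fun h => ⟨x, h, rfl⟩

variable [TopologicalSpace X]

/-- An orbit of dimension below `m - n` would lie in the skeleton below the lowest index, which is
empty. -/
theorem exists_hasOrbitDim (hnm : n ≤ m)
    (hF : IsFilteredSpace (l + (m - n)) (2 * n) X (orbitFiltration l m n X)) (x : X) :
    ∃ k, HasOrbitDim m x k ∧ m ≤ k + n := by
  have h1 : x ∈ orbitFiltration l m n X _ := hF.top ▸ mem_univ x
  obtain ⟨k, hk, -⟩ := h1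
  refine ⟨k, hk, ?_⟩
  by_contra! h
  have h2 : x ∈ orbitFiltration l m n X ((l + (m - n) : ℕ) - 1) := ⟨k, hk, by omega⟩
  rw [hF.bot] at h2
  exact h2

theorem mem_orbitFiltration_zero_iff
    (hF : IsFilteredSpace (l + (m - 0)) (2 * 0) X (orbitFiltration l m 0 X)) (j : ℤ) (x : X) :
    x ∈ orbitFiltration l m 0 X j ↔ (l + m : ℤ) ≤ j := by
  constructor
  · rintro ⟨k, hk, hkj⟩
    by_contra! h
    have h2 : x ∈ orbitFiltration l m 0 X ((l + (m - 0) : ℕ) - 1) := by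
      refine ⟨k, hk, ?_⟩
      have := hk.le
      omega
    rw [hF.bot] at h2
    exact h2
  · intro h
    obtain ⟨k, hk, hmk⟩ := exists_hasOrbitDim (Nat.zero_le m) hF x
    have := hk.le
    exact ⟨k, hk, by omega⟩

/-- Only the orbit dimensions `m - 1` and `m` occur, so the filtration jumps just at the indices `l
+ m - 1` and `l + m + 1`. -/
theorem mem_orbitFiltration_one_iff (hm : 1 ≤ m)
    (hF : IsFilteredSpace (l + (m - 1)) (2 * 1) X (orbitFiltration l m 1 X)) (j : ℤ) (x : X) :
    x ∈ orbitFiltration l m 1 X j ↔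
      (l + m + 1 : ℤ) ≤ j ∨ ((l + m - 1 : ℤ) ≤ j ∧ x ∈ nonfreePoints m X) := by
  obtain ⟨k₀, hk₀, hmk₀⟩ := exists_hasOrbitDim hm hF x
  have hk₀' := hk₀.le
  constructor
  · rintro ⟨k, hk, hkj⟩
    have hiff := hk.mem_nonfreePoints_iff
    have hiff₀ := hk₀.mem_nonfreePoints_iff
    have := hk.le
    by_cases h : k < m
    · have hmem := hiff.2 h
      have hk1 : m ≤ k + 1 := by
        by_contra! hlt
        have h2 : x ∈ orbitFiltration l m 1 X ((l + (m - 1) : ℕ) - 1) := ⟨k, hk, by omega⟩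
        rw [hF.bot] at h2
        exact h2
      exact Or.inr ⟨by omega, hmem⟩
    · exact Or.inl (by omega)
  · rintro (h | ⟨h, hx⟩)
    · exact ⟨k₀, hk₀, by omega⟩
    · have := hk₀.mem_nonfreePoints_iff.1 hx
      exact ⟨k₀, hk₀, by omega⟩

end

/-! ### Charts at points with one-dimensional isotropy -/

section

variable {l m : ℕ} {X : Type u} [TopologicalSpace X] [MulAction (Torus m) X]
  {x : X} {L : Type u} [TopologicalSpace L] [MulAction (Torus (1 - 0)) L]

/-- The links of points with one-dimensional isotropy are finite unions of free orbits. -/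
theorem IsLocallyStandard.exists_homeomorph {l' n' : ℕ} (h : l' + n' + 0 + 1 = 1)
    (hL : IsLocallyStandard l' (1 - 0) n' L) :
    CompactSpace L ∧ Nonempty L ∧ ∃ (N : ℕ) (f : L ≃ₜ Fin N × Torus (1 - 0)),
      ∀ (t : Torus (1 - 0)) (v : L), f (t • v) = ((f v).1, t * (f v).2) := by
  obtain ⟨rfl, rfl⟩ : l' = 0 ∧ n' = 0 := by omega
  rw [IsLocallyStandard] at hL
  obtain ⟨-, hc, -, -, -, -, -, hs, h0, -⟩ := hL
  rw [IsStratPseudomanifold] at hs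
  exact ⟨hc, hs.1.bot_nonempty.to_type, h0 rfl⟩

theorem TorusChart.mem_nonfreePoints_iff (c : TorusChart l m 1 0 x L)
    (hx : x ∈ nonfreePoints m X) {N : ℕ} (f : L ≃ₜ Fin N × Torus (1 - 0))
    (hf : ∀ (t : Torus (1 - 0)) (v : L), f (t • v) = ((f v).1, t * (f v).2)) (y : c.U) :
    (y : X) ∈ nonfreePoints m X ↔ (c.φ y).2.2 = OpenCone.vertex := by
  constructor
  · intro h
    by_contra hne
    refine h (c.stabilizer_eq_bot (fun t v htv => ?_) y hne)
    have := hf t v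
    rw [htv] at this
    simpa using (congrArg Prod.snd this).symm
  · intro h
    rw [nonfreePoints, mem_ofPred_eq, c.stabilizer_eq_of_vertex y h]
    exact hx

/-- The link cannot be empty: otherwise every point of the chart would have the isotropy group of
`x`, against the density of the free points. -/
theorem IsTorusLink.exists_model (h : IsTorusLink l m 1 0 x L)
    (hx : x ∈ nonfreePoints m X) (hdense : Dense (nonfreePoints m X)ᶜ) :
    CompactSpace L ∧ Nonempty L ∧ ∃ (_ : TorusChart l m 1 0 x L) (N : ℕ)
      (f : L ≃ₜ Fin N × Torus (1 - 0)),
      ∀ (t : Torus (1 - 0)) (v : L), f (t • v) = ((f v).1, t * (f v).2) := by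
  obtain ⟨c⟩ := h.2.nonempty
  rcases h.1 with hL | ⟨l', n', hln, hL⟩
  · obtain ⟨y, hyU, hy⟩ := hdense.inter_open_nonempty _ c.isOpen_U ⟨x, c.mem_U⟩
    refine absurd ?_ hy
    rw [nonfreePoints, mem_ofPred_eq,
      c.stabilizer_eq_of_vertex ⟨y, hyU⟩ (OpenCone.eq_vertex_of_isEmpty _)]
    exact hx
  · obtain ⟨hc, hne, N, f, hf⟩ := hL.exists_homeomorph hln
    exact ⟨hc, hne, c, N, f, hf⟩

namespace TorusChart

variable (c : TorusChart l m 1 0 x L)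

theorem isOpenEmbedding_symm : IsOpenEmbedding fun z => (c.φ.symm z : X) :=
  c.isOpen_U.isOpenEmbedding_coe_symm c.φ

theorem hasEuclideanChart_base (b : c.O × (c.Ω × Torus (m - 1))) :
    HasEuclideanChart (l + (m - 1)) b := by
  -- For `i = 0` the set `Ω` lies in the one-point space `(ℂ^×)^0` and contributes dimension zero.
  have h := (hasEuclideanChart_of_isOpen c.isOpen_O b.1).prodMk
    ((hasEuclideanChart_zero_of_discrete b.2.1).prodMk (hasEuclideanChart_torus b.2.2))
  rwa [zero_add] at h

/-- The chart, with the factors different from the cone collected. -/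
noncomputable def embed (z : (c.O × (c.Ω × Torus (m - 1))) × OpenCone L) : X := c.φ.symm (z.1.1, z.1.2, z.2)

theorem isOpenEmbedding_embed : IsOpenEmbedding c.embed :=
  c.isOpenEmbedding_symm.comp (Homeomorph.prodAssoc _ _ _).isOpenEmbedding

/-- The coordinates of the centre of the chart. -/
noncomputable def base : c.O × (c.Ω × Torus (m - 1)) := ((c.φ ⟨x, c.mem_U⟩).1, (c.φ ⟨x, c.mem_U⟩).2.1)

theorem embed_base {N : ℕ} (f : L ≃ₜ Fin N × Torus (1 - 0))
    (hf : ∀ (t : Torus (1 - 0)) (v : L), f (t • v) = ((f v).1, t * (f v).2))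
    (hx : x ∈ nonfreePoints m X) :
    c.embed (c.base, OpenCone.vertex) = x := by
  have := (c.mem_nonfreePoints_iff hx f hf ⟨x, c.mem_U⟩).1 hx
  rw [embed, base, ← this]
  simp

theorem embed_preimage {N : ℕ} (f : L ≃ₜ Fin N × Torus (1 - 0))
    (hf : ∀ (t : Torus (1 - 0)) (v : L), f (t • v) = ((f v).1, t * (f v).2))
    (hx : x ∈ nonfreePoints m X) :
    c.embed ⁻¹' nonfreePoints m X = {z | z.2 = OpenCone.vertex} := by
  ext z
  rw [mem_preimage, embed, c.mem_nonfreePoints_iff hx f hf]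
  simp

theorem locallyPreconnectedCompl_iff (c : TorusChart l m 1 0 x L) {N : ℕ}
    (f : L ≃ₜ Fin N × Torus (1 - 0))
    (hf : ∀ (t : Torus (1 - 0)) (v : L), f (t • v) = ((f v).1, t * (f v).2))
    (hx : x ∈ nonfreePoints m X) [CompactSpace L] :
    LocallyPreconnectedCompl (nonfreePoints m X) x ↔ PreconnectedSpace L := by
  have : LocallyConnectedSpace (c.O × (c.Ω × Torus (m - 1))) :=
    locallyConnectedSpace_of_hasEuclideanChart c.hasEuclideanChart_base
  rw [← locallyPreconnectedCompl_vertex_iff c.base, ← c.embed_preimage f hf hx,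
    ← c.isOpenEmbedding_embed.locallyPreconnectedCompl_iff, c.embed_base f hf hx]

theorem hasLocalRetract (c : TorusChart l m 1 0 x L) {N : ℕ}
    (f : L ≃ₜ Fin N × Torus (1 - 0))
    (hf : ∀ (t : Torus (1 - 0)) (v : L), f (t • v) = ((f v).1, t * (f v).2))
    (hx : x ∈ nonfreePoints m X) (hL : ¬ PreconnectedSpace L) :
    HasLocalRetract (EuclideanSpace ℝ (Fin (l + (m - 1))) × ℝ) x := by
  rw [← c.embed_base f hf hx]
  exact c.isOpenEmbedding_embed.hasLocalRetract
    (hasLocalRetract_vertex (c.hasEuclideanChart_base _) hL)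

theorem hasEuclideanChart (c : TorusChart l m 1 0 x L) {N : ℕ}
    (f : L ≃ₜ Fin N × Torus (1 - 0))
    (hf : ∀ (t : Torus (1 - 0)) (v : L), f (t • v) = ((f v).1, t * (f v).2))
    (hx : x ∈ nonfreePoints m X) [Nonempty L] (hL : PreconnectedSpace L) :
    HasEuclideanChart (l + (m - 1) + 2) x := by
  rw [← c.embed_base f hf hx]
  refine (c.isOpenEmbedding_embed.hasEuclideanChart_iff _).2 ?_
  have : Nonempty (Fin N) := ⟨(f (Classical.arbitrary L)).1⟩
  -- The connected discrete space `Fin N` is a single point, so `L` is one circle and its cone a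
  -- disc.
  have hN : PreconnectedSpace (Fin N) :=
    (Prod.fst_surjective.comp f.surjective).denseRange.preconnectedSpace (by fun_prop)
  have : Subsingleton (Fin N) := PreconnectedSpace.trivial_of_discrete
  have : Unique (Fin N) := ⟨⟨(f (Classical.arbitrary L)).1⟩, fun _ => Subsingleton.elim _ _⟩
  exact (c.hasEuclideanChart_base _).prodMk (hasEuclideanChart_cone_circle
    ((f.trans (Homeomorph.uniqueProd _ _)).trans (Homeomorph.funUnique (Fin 1) Circle)) _)

end TorusChart

end

/-! ### The orbit space -/

section

variable {m : ℕ} {X : Type u} [TopologicalSpace X] [MulAction (Torus m) X]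

theorem isOpenQuotientMap_orbitMk [ContinuousSMul (Torus m) X] :
    IsOpenQuotientMap (orbitMk m : X → OrbitSpace m X) :=
  MulAction.isOpenQuotientMap_quotientMk

/-- The action is proper because a continuous map from a compact space to a Hausdorff space is. -/
theorem t2Space_orbitSpace [CompactSpace X] [T2Space X] [ContinuousSMul (Torus m) X] :
    T2Space (OrbitSpace m X) := by
  have : ProperSMul (Torus m) X := by
    refine ⟨Continuous.isProperMap ?_⟩
    fun_prop
  infer_instance

theorem secondCountableTopology_orbitSpace [SecondCountableTopology X]
    [ContinuousSMul (Torus m) X] : SecondCountableTopology (OrbitSpace m X) :=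
  ContinuousConstSMul.secondCountableTopology

/-- An open map on an invariant open set whose fibres are the orbits is an open embedding of the
orbit space of this set. -/
theorem exists_isOpenEmbedding_orbitSpace [ContinuousSMul (Torus m) X] {Z : Type*}
    [TopologicalSpace Z] {U : Set X} (hU : IsOpen U) {f : U → Z} (hf : Continuous f)
    (hfo : IsOpenMap f) (hff : ∀ y z : U, f y = f z ↔ ∃ t : Torus m, t • (y : X) = z) :
    IsOpen (orbitMk m '' U) ∧ ∃ g : orbitMk m '' U → Z, IsOpenEmbedding g ∧
      ∀ y : U, g ⟨orbitMk m y, mem_image_of_mem _ y.2⟩ = f y := by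
  have hπ := isOpenQuotientMap_orbitMk (m := m) (X := X)
  have hUo : IsOpen (orbitMk m '' U) := hπ.isOpenMap _ hU
  let p : U → orbitMk m '' U := fun y => ⟨orbitMk m y, mem_image_of_mem _ y.2⟩
  have hpc : Continuous p := (hπ.continuous.comp continuous_subtype_val).subtype_mk _
  have hps : Function.Surjective p := by
    rintro ⟨_, y, hy, rfl⟩
    exact ⟨⟨y, hy⟩, rfl⟩
  have hpo : IsOpenMap p := (hπ.isOpenMap.comp hU.isOpenMap_subtype_val).subtype_mk _
  have hpq : IsOpenQuotientMap p := ⟨hps, hpc, hpo⟩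
  have hpf : ∀ y z, p y = p z ↔ f y = f z := fun y z => by
    rw [hff, ← orbitMk_eq_iff, Subtype.ext_iff]
  let g : orbitMk m '' U → Z := fun w => f (hps w).choose
  have hgp : ∀ y, g (p y) = f y := fun y => (hpf _ _).1 (hps (p y)).choose_spec
  refine ⟨hUo, g, .of_continuous_injective_isOpenMap ?_ ?_ ?_, hgp⟩
  · rw [← hpq.continuous_comp_iff, show g ∘ p = f from funext hgp]
    exact hf
  · intro w w' h
    obtain ⟨y, rfl⟩ := hps w
    obtain ⟨z, rfl⟩ := hps w'
    rw [hgp, hgp] at h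
    exact (hpf y z).2 h
  · rw [hpq.isOpenMap_iff, show g ∘ p = f from funext hgp]
    exact hfo

/-- One step of the filtration of the orbit space is two steps of that of `X`; the conditions at
both ends follow by monotonicity. -/
theorem isFilteredSpace_orbitSpace {l n : ℕ} (hnm : n ≤ m) [CompactSpace X] [T2Space X]
    [ContinuousSMul (Torus m) X]
    (hF : IsFilteredSpace (l + (m - n)) (2 * n) X (orbitFiltration l m n X)) :
    IsFilteredSpace l n (OrbitSpace m X) (orbitSpaceFiltration l m n X) := by
  have hπ := isOpenQuotientMap_orbitMk (m := m) (X := X)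
  refine ⟨t2Space_orbitSpace, fun j => ?_, fun i j hij => ?_, ?_, ?_, ?_, ?_⟩
  · rw [← hπ.isQuotientMap.isClosed_preimage]
    convert hF.closed (l + 2 * (j - l) + (m - n)) using 1
    ext x
    exact orbitMk_mem_orbitSpaceFiltration_iff x j
  · exact image_mono (hF.mono (by omega))
  · rw [eq_univ_iff_forall]
    intro q
    obtain ⟨x, rfl⟩ := orbitMk_surjective q
    rw [orbitMk_mem_orbitSpaceFiltration_iff]
    convert mem_univ x
    rw [← hF.top]
    congr 1
    omega
  · obtain ⟨x, hx⟩ := (ne_univ_iff_exists_notMem _).1 hF.top_proper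
    refine (ne_univ_iff_exists_notMem _).2 ⟨orbitMk m x, fun h => hx ?_⟩
    rw [orbitMk_mem_orbitSpaceFiltration_iff] at h
    exact hF.mono (by omega) h
  · obtain ⟨x, hx⟩ := hF.bot_nonempty
    refine ⟨orbitMk m x, ?_⟩
    rw [orbitMk_mem_orbitSpaceFiltration_iff]
    exact hF.mono (by omega) hx
  · rw [eq_empty_iff_forall_notMem]
    intro q hq
    obtain ⟨x, rfl⟩ := orbitMk_surjective q
    rw [orbitMk_mem_orbitSpaceFiltration_iff] at hq
    have : x ∈ orbitFiltration l m n X ((l + (m - n) : ℕ) - 1) := hF.mono (by omega) hq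
    rw [hF.bot] at this
    exact this

/-- Precomposition with the continuous surjection `exp : ℂ → ℂˣ` gives `Real.exp ∘ Complex.re`,
which is open. -/
theorem isOpenMap_norm_units : IsOpenMap fun w : ℂˣ => ‖(w : ℂ)‖ := by
  let E : ℂ → ℂˣ := fun z => Units.mk0 (Complex.exp z) (Complex.exp_ne_zero z)
  have hE : Continuous E := by
    rw [Units.isEmbedding_val₀.continuous_iff]
    exact Complex.continuous_exp
  have hs : Function.Surjective E := fun w =>
    ⟨Complex.log w, Units.ext (Complex.exp_log w.ne_zero)⟩
  refine IsOpenMap.of_comp hE hs ?_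
  have h2 : (fun w : ℂˣ => ‖(w : ℂ)‖) ∘ E = Real.exp ∘ Complex.re := by
    funext z
    exact Complex.norm_exp z
  rw [h2]
  exact Real.isOpenEmbedding_exp.isOpenMap.comp Complex.isOpenMap_re

theorem exists_torusMul_eq {i : ℕ} {w w' : Fin i → ℂˣ} (h : ∀ a, ‖(w a : ℂ)‖ = ‖(w' a : ℂ)‖) :
    ∃ t : Torus i, torusMul t w = w' := by
  have hmem : ∀ a, (w' a : ℂ) / (w a : ℂ) ∈ Submonoid.unitSphere ℂ := fun a => by
    have : ‖(w a : ℂ)‖ ≠ 0 := by simp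
    rw [Submonoid.unitSphere, Submonoid.mem_mk, Subsemigroup.mem_mk]
    simp [← h a, this]
  refine ⟨fun a => ⟨_, hmem a⟩, funext fun a => Units.ext ?_⟩
  simp only [torusMul, Units.val_mul]
  exact div_mul_cancel₀ _ (w a).ne_zero

theorem norm_torusMul {i : ℕ} (t : Torus i) (w : Fin i → ℂˣ) (a : Fin i) :
    ‖(torusMul t w a : ℂ)‖ = ‖(w a : ℂ)‖ := by
  simp [torusMul, Circle.norm_coe]

/-- The orbit space is locally Euclidean near free orbits. -/
theorem TorusChart.hasEuclideanChart_orbitMk [ContinuousSMul (Torus m) X] {l n : ℕ} {x : X}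
    {L : Type u} [TopologicalSpace L] [MulAction (Torus (n - n)) L] [IsEmpty L]
    (c : TorusChart l m n n x L) : HasEuclideanChart (l + n) (orbitMk m x) := by
  -- The norms are the orbit invariants of `U(1)^n` on `Ω`; the factor `U(1)^(m-n)` is a single
  -- orbit and the cone is a point.
  let ν : c.O × (c.Ω × Torus (m - n)) × OpenCone L → c.O × (Fin n → ℝ) :=
    Prod.map id ((Pi.map fun _ (w : ℂˣ) => ‖(w : ℂ)‖) ∘ Subtype.val ∘ Prod.fst ∘ Prod.fst)
  have hνc : Continuous ν := by
    refine continuous_id.prodMap ((Continuous.piMap fun _ => ?_).comp (by fun_prop))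
    exact continuous_norm.comp Units.continuous_val
  have hνo : IsOpenMap ν := by
    refine IsOpenMap.id.prodMap (IsOpenMap.comp ?_
      (c.isOpen_Ω.isOpenMap_subtype_val.comp (isOpenMap_fst.comp isOpenMap_fst)))
    exact IsOpenMap.piMap (fun _ => isOpenMap_norm_units) (by simp)
  obtain ⟨hUo, g, hg, hgf⟩ := exists_isOpenEmbedding_orbitSpace c.isOpen_U (f := ν ∘ c.φ)
    (hνc.comp c.φ.continuous) (hνo.comp c.φ.isOpenMap) (fun y z => by
      constructor
      · intro h
        obtain ⟨h1, h2⟩ := Prod.ext_iff.1 h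
        obtain ⟨s, hs⟩ := exists_torusMul_eq (fun a => congrFun h2 a)
        refine ⟨c.ψ.symm ((s, (c.φ z).2.1.2 * (c.φ y).2.1.2⁻¹), 1),
          (c.φ_smul_eq_iff _ _ _).2 ⟨h1.symm, ?_, ?_, ?_⟩⟩
        · simpa using hs.symm
        · simp
        · rw [OpenCone.eq_vertex_of_isEmpty (c.φ z).2.2, OpenCone.eq_vertex_of_isEmpty (c.φ y).2.2]
          rfl
      · rintro ⟨t, ht⟩
        obtain ⟨h1, h2, -, -⟩ := (c.φ_smul_eq_iff _ _ _).1 ht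
        refine Prod.ext h1.symm (funext fun a => ?_)
        change ‖(((c.φ y).2.1.1 : Fin n → ℂˣ) a : ℂ)‖ = ‖(((c.φ z).2.1.1 : Fin n → ℂˣ) a : ℂ)‖
        rw [h2, norm_torusMul])
  have h1 : HasEuclideanChart (l + n) (g ⟨orbitMk m x, mem_image_of_mem _ c.mem_U⟩) :=
    (hasEuclideanChart_of_isOpen c.isOpen_O _).prodMk (hasEuclideanChart_of_finrank (by simp) _)
  exact (hUo.isOpenEmbedding_subtypeVal.hasEuclideanChart_iff _).2
    ((hg.hasEuclideanChart_iff _).1 h1)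

end

section

variable {l m : ℕ} {X : Type u} [TopologicalSpace X] [MulAction (Torus m) X]
  {x : X} {L : Type u} [TopologicalSpace L] [MulAction (Torus (1 - 0)) L]

/-- At orbits with one-dimensional isotropy the orbit space is locally the product of an open set
and the cone on a finite set. -/
theorem TorusChart.hasLinkChart_orbitMk [ContinuousSMul (Torus m) X] (hm : 1 ≤ m)
    (hF : IsFilteredSpace (l + (m - 1)) (2 * 1) X (orbitFiltration l m 1 X))
    (c : TorusChart l m 1 0 x L) {N : ℕ} (f : L ≃ₜ Fin N × Torus (1 - 0))
    (hf : ∀ (t : Torus (1 - 0)) (v : L), f (t • v) = ((f v).1, t * (f v).2))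
    (hx : x ∈ nonfreePoints m X) :
    HasLinkChart (orbitSpaceFiltration l m 1 X) l 1 (orbitMk m x) (ULift.{u} (Fin N))
      fun j : ℤ => if 0 ≤ j then univ else ∅ := by
  let q : L → ULift.{u} (Fin N) := fun v => ⟨(f v).1⟩
  have hqc : Continuous q := continuous_uliftUp.comp (by fun_prop)
  have hqo : IsOpenMap q := Homeomorph.ulift.symm.isOpenMap.comp (isOpenMap_fst.comp f.isOpenMap)
  have hqs : Function.Surjective q := fun ⟨a⟩ => ⟨f.symm (a, 1), by simp [q]⟩
  -- The isotropy circle acts simply transitively on each circle of the link, so passing to orbits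
  -- replaces the cone on the circles by the cone on their index set. The torus factor disappears.
  let ν : c.O × (c.Ω × Torus (m - 1)) × OpenCone L → c.O × OpenCone (ULift.{u} (Fin N)) :=
    Prod.map id (OpenCone.push q ∘ Prod.snd)
  have hνc : Continuous ν :=
    continuous_id.prodMap ((OpenCone.continuous_push hqc).comp continuous_snd)
  have hνo : IsOpenMap ν :=
    IsOpenMap.id.prodMap ((OpenCone.isOpenMap_push hqo hqs).comp isOpenMap_snd)
  have hvert : ∀ y : OpenCone L, OpenCone.push q y = OpenCone.vertex ↔ y = OpenCone.vertex := by
    intro y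
    rcases y.eq_vertex_or with rfl | ⟨v, s, hs, rfl⟩
    · simp
    · simp [OpenCone.mk_eq_vertex_iff]
  have hcone : ∀ y z : OpenCone L, OpenCone.push q y = OpenCone.push q z →
      ∃ t : Torus (1 - 0), z = OpenCone.map (fun v => t • v) y := by
    intro y z h
    rcases y.eq_vertex_or with rfl | ⟨v, s, hs, rfl⟩
    · refine ⟨1, ?_⟩
      rw [OpenCone.map_vertex]
      exact (hvert z).1 h.symm
    · rcases z.eq_vertex_or with rfl | ⟨w, s', hs', rfl⟩
      · exact ⟨1, absurd ((OpenCone.mk_eq_vertex_iff _ _).1 ((hvert _).1 h)) hs.ne'⟩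
      · obtain ⟨h1, rfl⟩ := OpenCone.mk_inj hs h
        refine ⟨(f w).2 * (f v).2⁻¹, ?_⟩
        rw [OpenCone.map_mk]
        congr 1
        apply f.injective
        rw [hf]
        refine Prod.ext (congrArg ULift.down h1).symm ?_
        simp
  have hmap : ∀ (t : Torus (1 - 0)) (y : OpenCone L),
      OpenCone.push q (OpenCone.map (fun v => t • v) y) = OpenCone.push q y := by
    intro t y
    rcases y.eq_vertex_or with rfl | ⟨v, s, hs, rfl⟩
    · rfl
    · simp [OpenCone.map_mk, q, hf]
  have hνs : Function.Surjective ν := by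
    rintro ⟨o, y⟩
    obtain ⟨z, rfl⟩ := OpenCone.push_surjective hqs y
    exact ⟨(o, (c.φ ⟨x, c.mem_U⟩).2.1, z), rfl⟩
  obtain ⟨hUo, g, hg, hgf⟩ := exists_isOpenEmbedding_orbitSpace c.isOpen_U (f := ν ∘ c.φ)
    (hνc.comp c.φ.continuous) (hνo.comp c.φ.isOpenMap) (fun y z => by
      constructor
      · intro h
        obtain ⟨h1, h2⟩ := Prod.ext_iff.1 h
        obtain ⟨t, ht⟩ := hcone _ _ h2
        refine ⟨c.ψ.symm ((1, (c.φ z).2.1.2 * (c.φ y).2.1.2⁻¹), t),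
          (c.φ_smul_eq_iff _ _ _).2 ⟨h1.symm, Subsingleton.elim _ _, ?_, ?_⟩⟩
        · simp
        · simpa using ht
      · rintro ⟨t, ht⟩
        obtain ⟨h1, -, -, h4⟩ := (c.φ_smul_eq_iff _ _ _).1 ht
        refine Prod.ext h1.symm ?_
        change OpenCone.push q (c.φ y).2.2 = OpenCone.push q (c.φ z).2.2
        rw [h4, hmap])
  have hgs : Function.Surjective g := by
    intro w
    obtain ⟨z, rfl⟩ := hνs w
    refine ⟨⟨orbitMk m (c.φ.symm z), mem_image_of_mem _ (c.φ.symm z).2⟩, ?_⟩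
    rw [hgf]
    simp
  refine ⟨orbitMk m '' c.U, hUo, mem_image_of_mem _ c.mem_U, c.O, c.isOpen_O, c.contractible_O,
    hg.isEmbedding.toHomeomorphOfSurjective hgs, by simp, ?_⟩
  rintro j hj hj' ⟨_, y, hy, rfl⟩
  have hgy : hg.isEmbedding.toHomeomorphOfSurjective hgs
      ⟨orbitMk m y, mem_image_of_mem _ hy⟩ = ν (c.φ ⟨y, hy⟩) := hgf ⟨y, hy⟩
  rw [hgy, orbitMk_mem_orbitSpaceFiltration_iff, mem_orbitFiltration_one_iff hm hF]
  obtain rfl | rfl : j = -1 ∨ j = 0 := by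
    have : ((1 : ℕ) : ℤ) = 1 := rfl
    omega
  · have h1 := c.mem_nonfreePoints_iff hx f hf ⟨y, hy⟩
    simp only [Int.reduceNeg, Left.nonneg_neg_iff, Int.reduceLE, if_false, OpenCone.mem_sub_empty]
    change _ ↔ OpenCone.push q (c.φ ⟨y, hy⟩).2.2 = OpenCone.vertex
    rw [hvert, ← h1]
    constructor
    · rintro (h | ⟨-, h⟩)
      · omega
      · exact h
    · exact fun h => Or.inr ⟨by omega, h⟩
  · simp only [le_refl, if_true, OpenCone.mem_sub_univ, iff_true]
    exact Or.inl (by omega)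

end

/-! ### The orbit space as a stratified pseudomanifold -/

theorem IsStratPseudomanifold.isFilteredSpace {l n : ℕ} {Q : Type u} [TopologicalSpace Q]
    {F : ℤ → Set Q} (h : IsStratPseudomanifold l n Q F) : IsFilteredSpace l n Q F := by
  rw [IsStratPseudomanifold] at h
  exact h.1

theorem IsStratPseudomanifold.dense {l n : ℕ} {Q : Type u} [TopologicalSpace Q]
    {F : ℤ → Set Q} (h : IsStratPseudomanifold l n Q F) (hln : l + n ≠ 0) :
    Dense (F (l + n) \ F (l + n - 1)) := by
  rw [IsStratPseudomanifold] at h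
  exact (h.2.2 hln).2.1

theorem IsStratPseudomanifold.exists_isLink {l n : ℕ} {Q : Type u} [TopologicalSpace Q]
    {F : ℤ → Set Q} (h : IsStratPseudomanifold l n Q F) (hln : l + n ≠ 0) {i : ℕ} (hi : i ≤ n)
    {p : Q} (hp : p ∈ F (l + i) \ F (l + i - 1)) :
    ∃ (L : Type u) (_ : TopologicalSpace L) (G : ℤ → Set L), IsLink l n F i p L G := by
  rw [IsStratPseudomanifold] at h
  obtain ⟨L, _, G, hc, hL, hch⟩ := (h.2.2 hln).2.2 i hi p hp
  refine ⟨L, _, G, hc, hL.imp_right ?_, hch⟩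
  rintro ⟨l', n', h1, h2⟩
  exact ⟨l', n', h1, h2⟩

theorem IsLink.isEmpty {l n : ℕ} {Q : Type u} [TopologicalSpace Q] {F : ℤ → Set Q} {p : Q}
    {L : Type u} [TopologicalSpace L] {G : ℤ → Set L} (h : IsLink l n F n p L G) : IsEmpty L := by
  rcases h.2.1 with h | ⟨l', n', h, -⟩
  · exact h
  · omega

theorem IsTorusLink.isEmpty {l m n : ℕ} {X : Type u} [TopologicalSpace X] [MulAction (Torus m) X]
    {x : X} {L : Type u} [TopologicalSpace L] [MulAction (Torus (n - n)) L]
    (h : IsTorusLink l m n n x L) : IsEmpty L := by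
  rcases h.1 with h | ⟨l', n', h, -⟩
  · exact h
  · omega

theorem preconnectedSpace_of_isEmpty (L : Type*) [TopologicalSpace L] [IsEmpty L] :
    PreconnectedSpace L :=
  ⟨by rw [univ_eq_empty_iff.2 ‹_›]; exact isPreconnected_empty⟩

/-- A stratified pseudomanifold is locally Euclidean away from its singular set. -/
theorem IsStratPseudomanifold.hasEuclideanChart {l n : ℕ} {Q : Type u} [TopologicalSpace Q]
    {F : ℤ → Set Q} (h : IsStratPseudomanifold l n Q F) {p : Q}
    (hp : p ∈ F (l + n) \ F (l + n - 1)) : HasEuclideanChart (l + n) p := by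
  by_cases hln : l + n = 0
  · rw [IsStratPseudomanifold] at h
    have := h.2.1 hln
    rw [hln]
    exact hasEuclideanChart_zero_of_discrete p
  · obtain ⟨L, _, G, hL⟩ := h.exists_isLink hln le_rfl hp
    have := hL.isEmpty
    exact hL.2.2.hasEuclideanChart

theorem IsFilteredSpace.isManifoldOfDim_top {l n : ℕ} {Q : Type u} [TopologicalSpace Q]
    [SecondCountableTopology Q] {F : ℤ → Set Q} (hF : IsFilteredSpace l n Q F)
    (h : ∀ p ∈ F (l + n) \ F (l + n - 1), HasEuclideanChart (l + n) p) {p : Q}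
    (hp : p ∈ F (l + n) \ F (l + n - 1)) :
    IsManifoldOfDim (l + n) (connectedComponentIn (F (l + n) \ F (l + n - 1)) p) := by
  have := hF.t2
  refine isManifoldOfDim_connectedComponentIn (fun x => ?_) p hp
  have hopen : IsOpen (F (l + n) \ F (l + n - 1)) := by
    rw [hF.top]
    exact isOpen_univ.sdiff (hF.closed _)
  exact (hopen.isOpenEmbedding_subtypeVal.hasEuclideanChart_iff x).1 (h _ x.2)

theorem IsFilteredSpace.exists_empty_link {l n : ℕ} {Q : Type u} [TopologicalSpace Q]
    {F : ℤ → Set Q} (hF : IsFilteredSpace l n Q F) {p : Q} (h : HasEuclideanChart (l + n) p) :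
    ∃ (L : Type u) (_ : TopologicalSpace L) (G : ℤ → Set L), CompactSpace L ∧
      (IsEmpty L ∨ ∃ (l' n' : ℕ) (_ : l' + n' + n + 1 = n), IsStratPseudomanifold l' n' L G) ∧
      HasLinkChart F (l + n) (n - n) p L G := by
  refine ⟨PEmpty, inferInstance, fun _ => ∅, inferInstance, Or.inl inferInstance, ?_⟩
  rw [Nat.sub_self]
  exact h.hasLinkChart (by rw [Nat.cast_add, hF.top])

section

variable {l m n : ℕ} {X : Type u} [TopologicalSpace X] [MulAction (Torus m) X]

theorem IsLocallyStandard.exists_isTorusLink (hX : IsLocallyStandard l m n X) (hln : l + n ≠ 0)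
    {i : ℕ} (hi : i ≤ n) {x : X} (hx : x ∈ orbitFiltration l m n X (l + 2 * i + (m - n)) \
        orbitFiltration l m n X (l + 2 * (i - 1) + (m - n))) :
    ∃ (L : Type u) (_ : TopologicalSpace L) (_ : MulAction (Torus (n - i)) L),
      IsTorusLink l m n i x L := by
  rw [IsLocallyStandard] at hX
  obtain ⟨-, -, -, -, -, -, -, -, -, hlink⟩ := hX
  obtain ⟨L, _, _, hL, hch⟩ := hlink hln i hi x hx
  refine ⟨L, _, _, hL.imp_right ?_, hch⟩
  rintro ⟨l', n', h1, h2⟩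
  exact ⟨l', n', h1, h2⟩

theorem IsLocallyStandard.hasEuclideanChart_orbitMk (hX : IsLocallyStandard l m n X)
    (hln : l + n ≠ 0) {x : X} (hx : x ∈ orbitFiltration l m n X (l + 2 * n + (m - n)) \
        orbitFiltration l m n X (l + 2 * (n - 1) + (m - n))) :
    HasEuclideanChart (l + n) (orbitMk m x) := by
  obtain ⟨L, _, _, hL⟩ := hX.exists_isTorusLink hln le_rfl hx
  rw [IsLocallyStandard] at hX
  obtain ⟨-, -, -, -, hsm, -⟩ := hX
  have := hL.isEmpty
  obtain ⟨c⟩ := hL.2.nonempty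
  exact c.hasEuclideanChart_orbitMk

/-- If `n = 0`, all points have orbits of the same dimension and all four conditions hold. -/
theorem IsLocallyStandard.zero (hX : IsLocallyStandard l m 0 X) :
    IsTopologicalManifold X ∧
      IsNormalStrat (l + (m - 0)) (2 * 0) X (orbitFiltration l m 0 X) ∧
      HasConnectedTorusLinks l m 0 X ∧
      IsNormalStrat l 0 (OrbitSpace m X) (orbitSpaceFiltration l m 0 X) := by
  have hX' := hX
  rw [IsLocallyStandard] at hX
  obtain ⟨-, hc, ht2, hsc, hsm, -, -, hstrat, h0, -⟩ := hX
  have hF := hstrat.isFilteredSpace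
  have hFQ := isFilteredSpace_orbitSpace (Nat.zero_le m) hF
  have hsQ : SecondCountableTopology (OrbitSpace m X) := secondCountableTopology_orbitSpace
  refine ⟨⟨_, isManifoldOfDim_of_hasEuclideanChart fun x => hstrat.hasEuclideanChart ?_⟩,
    ⟨hstrat, ?_⟩, ?_, ?_, ?_⟩
  · rw [mem_sdiff, mem_orbitFiltration_zero_iff hF, mem_orbitFiltration_zero_iff hF]
    omega
  · intro i hi p hp L _ G hL
    obtain rfl : i = 2 * 0 := by omega
    have := hL.isEmpty
    exact preconnectedSpace_of_isEmpty L
  · intro i hi x hx L _ _ hL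
    obtain rfl : i = 0 := by omega
    have := hL.isEmpty
    exact preconnectedSpace_of_isEmpty L
  · have hch : l + 0 ≠ 0 → ∀ q : OrbitSpace m X, HasEuclideanChart (l + 0) q := by
      intro hl q
      obtain ⟨x, rfl⟩ := orbitMk_surjective q
      refine hX'.hasEuclideanChart_orbitMk hl ?_
      rw [mem_sdiff, mem_orbitFiltration_zero_iff hF, mem_orbitFiltration_zero_iff hF]
      omega
    rw [IsStratPseudomanifold]
    refine ⟨hFQ, fun hl => ?_, fun hl => ⟨fun i hi p hp => ?_, ?_, fun i hi p hp => ?_⟩⟩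
    · obtain ⟨N, f, hf⟩ := h0 hl
      have hπ := isOpenQuotientMap_orbitMk (m := m) (X := X)
      rw [discreteTopology_iff_isOpen_singleton]
      intro q
      obtain ⟨x, rfl⟩ := orbitMk_surjective q
      rw [← hπ.isQuotientMap.isOpen_preimage]
      -- For `l = 0` the orbits are the fibres of the projection of `X ≃ₜ Fin N × Torus m` to `Fin
      -- N`.
      convert (isOpen_discrete {(f x).1}).preimage (continuous_fst.comp f.continuous) using 1
      ext y
      simp only [mem_preimage, mem_singleton_iff, Function.comp_apply, orbitMk_eq_iff]
      constructor
      · rintro ⟨t, rfl⟩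
        rw [hf]
      · intro h
        refine ⟨(f x).2 * (f y).2⁻¹, f.injective ?_⟩
        rw [hf]
        exact Prod.ext h (by simp)
    · obtain rfl : i = 0 := by omega
      exact hFQ.isManifoldOfDim_top (fun q _ => hch hl q) hp
    · have h1 := hFQ.top
      have h2 := hFQ.bot
      simp only [Nat.cast_zero, add_zero] at h1 h2 ⊢
      rw [h1, h2, sdiff_empty]
      exact dense_univ
    · obtain rfl : i = 0 := by omega
      exact hFQ.exists_empty_link (hch hl p)
  · intro i hi p hp L _ G hL
    obtain rfl : i = 0 := by omega
    have := hL.isEmpty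
    exact preconnectedSpace_of_isEmpty L

/-! ### One-dimensional isotropy -/

theorem preconnectedSpace_torus (k : ℕ) : PreconnectedSpace (Torus k) := by
  have : PreconnectedSpace Circle :=
    Circle.exp_surjective.denseRange.preconnectedSpace Circle.exp.continuous
  infer_instance

/-- The torus is connected, so the components of `L` correspond to the points of `Fin N`; this links
condition 4 with the others. -/
theorem preconnectedSpace_ulift_fin_iff {N k : ℕ} {L : Type u} [TopologicalSpace L]
    (f : L ≃ₜ Fin N × Torus k) : PreconnectedSpace (ULift.{u} (Fin N)) ↔ PreconnectedSpace L := by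
  constructor
  · intro h
    have : Subsingleton (Fin N) :=
      ⟨fun a b => ULift.up_injective ((PreconnectedSpace.trivial_of_discrete
        (X := ULift.{u} (Fin N))).elim _ _)⟩
    have := preconnectedSpace_torus k
    have hN : PreconnectedSpace (Fin N) := ⟨subsingleton_univ.isPreconnected⟩
    exact f.symm.surjective.denseRange.preconnectedSpace f.symm.continuous
  · intro h
    have hs : Function.Surjective fun v : L => ULift.up.{u} (f v).1 :=
      fun ⟨a⟩ => ⟨f.symm (a, 1), by simp⟩
    exact hs.denseRange.preconnectedSpace (continuous_uliftUp.comp (by fun_prop))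

namespace IsLocallyStandard

theorem isStratPseudomanifold (hX : IsLocallyStandard l m n X) :
    IsStratPseudomanifold (l + (m - n)) (2 * n) X (orbitFiltration l m n X) := by
  rw [IsLocallyStandard] at hX
  exact hX.2.2.2.2.2.2.2.1

theorem le (hX : IsLocallyStandard l m n X) : n ≤ m := by
  rw [IsLocallyStandard] at hX
  exact hX.1

theorem mem_orbitFiltration_iff (hX : IsLocallyStandard l m 1 X) (j : ℤ) (x : X) :
    x ∈ orbitFiltration l m 1 X j ↔
      (l + m + 1 : ℤ) ≤ j ∨ ((l + m - 1 : ℤ) ≤ j ∧ x ∈ nonfreePoints m X) :=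
  mem_orbitFiltration_one_iff hX.le hX.isStratPseudomanifold.isFilteredSpace j x

theorem dense_compl_nonfreePoints (hX : IsLocallyStandard l m 1 X) :
    Dense (nonfreePoints m X)ᶜ := by
  have hm := hX.le
  convert hX.isStratPseudomanifold.dense (by omega) using 1
  ext x
  rw [mem_sdiff, hX.mem_orbitFiltration_iff, hX.mem_orbitFiltration_iff, mem_compl_iff]
  constructor
  · exact fun h => ⟨Or.inl (by omega), by rintro (h' | ⟨-, h'⟩) <;> [omega; exact h h']⟩
  · exact fun h h' => h.2 (Or.inr ⟨by omega, h'⟩)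

theorem hasEuclideanChart (hX : IsLocallyStandard l m 1 X) {x : X} (hx : x ∉ nonfreePoints m X) :
    HasEuclideanChart (l + (m - 1) + 2) x := by
  have hm := hX.le
  refine hX.isStratPseudomanifold.hasEuclideanChart ?_
  rw [mem_sdiff, hX.mem_orbitFiltration_iff, hX.mem_orbitFiltration_iff]
  exact ⟨Or.inl (by omega), by rintro (h' | ⟨-, h'⟩) <;> [omega; exact hx h']⟩

theorem exists_torusLink (hX : IsLocallyStandard l m 1 X) {x : X} (hx : x ∈ nonfreePoints m X) :
    ∃ (L : Type u) (_ : TopologicalSpace L) (_ : MulAction (Torus (1 - 0)) L),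
      IsTorusLink l m 1 0 x L := by
  have hm := hX.le
  refine hX.exists_isTorusLink (by omega) (by omega) ?_
  rw [mem_sdiff, hX.mem_orbitFiltration_iff, hX.mem_orbitFiltration_iff]
  exact ⟨Or.inr ⟨by omega, hx⟩, by rintro (h' | ⟨h', -⟩) <;> omega⟩

theorem exists_model (hX : IsLocallyStandard l m 1 X) {x : X} (hx : x ∈ nonfreePoints m X) :
    ∃ (L : Type u) (_ : TopologicalSpace L) (_ : MulAction (Torus (1 - 0)) L)
      (_ : CompactSpace L) (_ : Nonempty L) (_ : TorusChart l m 1 0 x L) (N : ℕ)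
      (f : L ≃ₜ Fin N × Torus (1 - 0)),
      ∀ (t : Torus (1 - 0)) (v : L), f (t • v) = ((f v).1, t * (f v).2) := by
  obtain ⟨L, _, _, hL⟩ := hX.exists_torusLink hx
  obtain ⟨hc, hne, c, N, f, hf⟩ := hL.exists_model hx hX.dense_compl_nonfreePoints
  exact ⟨L, _, _, hc, hne, c, N, f, hf⟩

/-- A disconnected link bounds the dimension at `x` by `l + m`, while free points have charts of
dimension `l + m + 1`. The bound `l + m ≤ 2` keeps both dimension comparisons in the range covered
by elementary arguments. -/
theorem isTopologicalManifold_iff (hX : IsLocallyStandard l m 1 X) (hlm : l + m ≤ 2) :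
    IsTopologicalManifold X ↔
      ∀ x ∈ nonfreePoints m X, LocallyPreconnectedCompl (nonfreePoints m X) x := by
  have hm := hX.le
  constructor
  · rintro ⟨k, hk⟩ x hx
    obtain ⟨L, _, _, hc, hne, c, N, f, hf⟩ := hX.exists_model hx
    rw [c.locallyPreconnectedCompl_iff f hf hx]
    by_contra hL
    have hfin : Module.finrank ℝ (EuclideanSpace ℝ (Fin (l + (m - 1))) × ℝ) = l + (m - 1) + 1 := by
      simp
    have h1 := (c.hasLocalRetract f hf hx hL).le_finrank (by omega) (by omega)
      (hk.hasEuclideanChart x)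
    have : Nonempty X := ⟨x⟩
    obtain ⟨y, hy⟩ := hX.dense_compl_nonfreePoints.nonempty
    -- The dimension `k` is the same at `y` as at `x`, and `h1` gives `k ≤ l + m ≤ 2`.
    have h2 := (hk.hasEuclideanChart y).le_of_le_two (hX.hasEuclideanChart hy) (by omega)
    omega
  · intro h
    have hX' := hX
    rw [IsLocallyStandard] at hX'
    obtain ⟨-, -, ht2, hsc, -⟩ := hX'
    refine ⟨l + (m - 1) + 2, isManifoldOfDim_of_hasEuclideanChart fun x => ?_⟩
    by_cases hx : x ∈ nonfreePoints m X
    · obtain ⟨L, _, _, hc, hne, c, N, f, hf⟩ := hX.exists_model hx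
      exact c.hasEuclideanChart f hf hx ((c.locallyPreconnectedCompl_iff f hf hx).1 (h x hx))
    · exact hX.hasEuclideanChart hx

theorem hasConnectedTorusLinks_iff (hX : IsLocallyStandard l m 1 X) :
    HasConnectedTorusLinks l m 1 X ↔
      ∀ x ∈ nonfreePoints m X, LocallyPreconnectedCompl (nonfreePoints m X) x := by
  have hm := hX.le
  have hmem : ∀ x : X, x ∈ orbitFiltration l m 1 X (l + 2 * (0 : ℕ) + (m - (1 : ℕ))) \
      orbitFiltration l m 1 X (l + 2 * ((0 : ℕ) - 1) + (m - (1 : ℕ))) ↔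
      x ∈ nonfreePoints m X := by
    intro x
    rw [mem_sdiff, hX.mem_orbitFiltration_iff, hX.mem_orbitFiltration_iff]
    constructor
    · rintro ⟨h | ⟨-, h⟩, -⟩
      · omega
      · exact h
    · exact fun hx => ⟨Or.inr ⟨by omega, hx⟩, by rintro (h' | ⟨h', -⟩) <;> omega⟩
  constructor
  · intro h x hx
    obtain ⟨L, _, _, hL⟩ := hX.exists_torusLink hx
    obtain ⟨hc, hne, c, N, f, hf⟩ := hL.exists_model hx hX.dense_compl_nonfreePoints
    rw [c.locallyPreconnectedCompl_iff f hf hx]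
    exact h 0 (by omega) x ((hmem x).2 hx) L hL
  · intro h i hi x hx L _ _ hL
    obtain rfl | rfl : i = 0 ∨ i = 1 := by omega
    · have hx' := (hmem x).1 hx
      obtain ⟨hc, hne, c, N, f, hf⟩ := hL.exists_model hx' hX.dense_compl_nonfreePoints
      exact (c.locallyPreconnectedCompl_iff f hf hx').1 (h x hx')
    · have := hL.isEmpty
      exact preconnectedSpace_of_isEmpty L

theorem isNormalStrat_iff (hX : IsLocallyStandard l m 1 X) :
    IsNormalStrat (l + (m - 1)) (2 * 1) X (orbitFiltration l m 1 X) ↔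
      ∀ x ∈ nonfreePoints m X, LocallyPreconnectedCompl (nonfreePoints m X) x := by
  have hm := hX.le
  have hS : orbitFiltration l m 1 X (l + (m - 1) + 0 : ℕ) = nonfreePoints m X := by
    ext x
    rw [hX.mem_orbitFiltration_iff]
    exact ⟨by rintro (h | ⟨-, h⟩) <;> [omega; exact h], fun h => Or.inr ⟨by omega, h⟩⟩
  have hlink : ∀ x ∈ nonfreePoints m X, ∀ (L : Type u) [TopologicalSpace L] (G : ℤ → Set L),
      IsLink (l + (m - 1)) (2 * 1) (orbitFiltration l m 1 X) 0 x L G →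
      (LocallyPreconnectedCompl (nonfreePoints m X) x ↔ PreconnectedSpace L) := by
    intro x hx L _ G hL
    have := hL.1
    rw [← hL.2.2.locallyPreconnectedCompl_iff (by rwa [hS]), hS]
  have hmem : ∀ x : X, x ∈ orbitFiltration l m 1 X ((l + (m - 1) : ℕ) + (0 : ℕ)) \
      orbitFiltration l m 1 X ((l + (m - 1) : ℕ) + (0 : ℕ) - 1) ↔ x ∈ nonfreePoints m X := by
    intro x
    rw [mem_sdiff, hX.mem_orbitFiltration_iff, hX.mem_orbitFiltration_iff]
    constructor
    · rintro ⟨h | ⟨-, h⟩, -⟩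
      · omega
      · exact h
    · exact fun hx => ⟨Or.inr ⟨by omega, hx⟩, by rintro (h' | ⟨h', -⟩) <;> omega⟩
  constructor
  · rintro ⟨-, h⟩ x hx
    obtain ⟨L, _, G, hL⟩ := hX.isStratPseudomanifold.exists_isLink (by omega) (Nat.zero_le _)
      ((hmem x).2 hx)
    exact (hlink x hx L G hL).2 (h 0 (Nat.zero_le _) x ((hmem x).2 hx) L G hL)
  · intro h
    refine ⟨hX.isStratPseudomanifold, fun i hi x hx L _ G hL => ?_⟩
    obtain rfl | rfl | rfl : i = 0 ∨ i = 1 ∨ i = 2 * 1 := by omega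
    · have hx' := (hmem x).1 hx
      exact (hlink x hx' L G hL).1 (h x hx')
    -- The stratum of codimension one is empty: the skeleta with indices `l + m - 1` and `l + m`
    -- coincide.
    · rw [mem_sdiff, hX.mem_orbitFiltration_iff, hX.mem_orbitFiltration_iff] at hx
      obtain ⟨h1 | ⟨-, h1⟩, h2⟩ := hx
      · omega
      · exact absurd (Or.inr ⟨by omega, h1⟩) h2
    · have := hL.isEmpty
      exact preconnectedSpace_of_isEmpty L

theorem orbitMk_mem_iff (hX : IsLocallyStandard l m 1 X) (j : ℤ) (x : X) :
    orbitMk m x ∈ orbitSpaceFiltration l m 1 X j ↔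
      (l + 1 : ℤ) ≤ j ∨ ((l : ℤ) ≤ j ∧ x ∈ nonfreePoints m X) := by
  have hm := hX.le
  rw [orbitMk_mem_orbitSpaceFiltration_iff, hX.mem_orbitFiltration_iff]
  exact or_congr (by omega) (and_congr_left fun _ => by omega)

theorem orbitMk_mem_zero_iff (hX : IsLocallyStandard l m 1 X) (x : X) :
    orbitMk m x ∈ orbitSpaceFiltration l m 1 X (l + (0 : ℕ)) \
      orbitSpaceFiltration l m 1 X (l + (0 : ℕ) - 1) ↔ x ∈ nonfreePoints m X := by
  rw [mem_sdiff, hX.orbitMk_mem_iff, hX.orbitMk_mem_iff]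
  constructor
  · rintro ⟨h | ⟨-, h⟩, -⟩
    · omega
    · exact h
  · exact fun hx => ⟨Or.inr ⟨by omega, hx⟩, by rintro (h' | ⟨h', -⟩) <;> omega⟩

theorem orbitMk_mem_one_iff (hX : IsLocallyStandard l m 1 X) (x : X) :
    orbitMk m x ∈ orbitSpaceFiltration l m 1 X (l + (1 : ℕ)) \
      orbitSpaceFiltration l m 1 X (l + (1 : ℕ) - 1) ↔ x ∉ nonfreePoints m X := by
  rw [mem_sdiff, hX.orbitMk_mem_iff, hX.orbitMk_mem_iff]
  constructor
  · exact fun h h' => h.2 (Or.inr ⟨by omega, h'⟩)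
  · exact fun h => ⟨Or.inl (by omega), by rintro (h' | ⟨-, h'⟩) <;> [omega; exact h h']⟩

theorem exists_isLink_orbitMk (hX : IsLocallyStandard l m 1 X) {x : X}
    (hx : x ∈ nonfreePoints m X) : ∃ (N : ℕ) (_ : Nonempty (Fin N)),
      HasLinkChart (orbitSpaceFiltration l m 1 X) l 1 (orbitMk m x) (ULift.{u} (Fin N))
        (fun j : ℤ => if 0 ≤ j then univ else ∅) ∧
      (PreconnectedSpace (ULift.{u} (Fin N)) ↔
        LocallyPreconnectedCompl (nonfreePoints m X) x) := by
  obtain ⟨L, _, _, hc, ⟨v⟩, c, N, f, hf⟩ := hX.exists_model hx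
  have hX' := hX
  rw [IsLocallyStandard] at hX'
  obtain ⟨-, -, -, -, hsm, -⟩ := hX'
  refine ⟨N, ⟨(f v).1⟩, c.hasLinkChart_orbitMk hX.le hX.isStratPseudomanifold.isFilteredSpace
    f hf hx, ?_⟩
  rw [c.locallyPreconnectedCompl_iff f hf hx, preconnectedSpace_ulift_fin_iff f]

theorem isStratPseudomanifold_orbitSpace (hX : IsLocallyStandard l m 1 X) :
    IsStratPseudomanifold l 1 (OrbitSpace m X) (orbitSpaceFiltration l m 1 X) := by
  have hX' := hX
  rw [IsLocallyStandard] at hX'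
  obtain ⟨hm, hc, ht2, hsc, hsm, -⟩ := hX'
  have hFQ := isFilteredSpace_orbitSpace hm hX.isStratPseudomanifold.isFilteredSpace
  have := hFQ.t2
  have hsQ : SecondCountableTopology (OrbitSpace m X) := secondCountableTopology_orbitSpace
  have hch : ∀ q ∈ orbitSpaceFiltration l m 1 X (l + (1 : ℕ)) \
      orbitSpaceFiltration l m 1 X (l + (1 : ℕ) - 1), HasEuclideanChart (l + 1) q := by
    intro q hq
    obtain ⟨x, rfl⟩ := orbitMk_surjective q
    rw [hX.orbitMk_mem_one_iff] at hq
    refine hX.hasEuclideanChart_orbitMk (by omega) ?_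
    rw [mem_sdiff, hX.mem_orbitFiltration_iff, hX.mem_orbitFiltration_iff]
    exact ⟨Or.inl (by omega), by rintro (h' | ⟨-, h'⟩) <;> [omega; exact hq h']⟩
  rw [IsStratPseudomanifold]
  refine ⟨hFQ, fun h => by omega, fun _ => ⟨fun i hi p hp => ?_, ?_, fun i hi p hp => ?_⟩⟩
  · obtain rfl | rfl : i = 0 ∨ i = 1 := by omega
    · refine isManifoldOfDim_connectedComponentIn (fun q => ?_) p hp
      have hS : orbitSpaceFiltration l m 1 X (l + (0 : ℕ)) \
          orbitSpaceFiltration l m 1 X (l + (0 : ℕ) - 1) = orbitSpaceFiltration l m 1 X l := by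
        have h2 := hFQ.bot
        simp only [Nat.cast_zero, add_zero]
        rw [h2, sdiff_empty]
      obtain ⟨q, hq⟩ := q
      -- Quantifying over the set `A` allows the equality `hS` to be substituted under the subtype.
      have key : ∀ (A : Set (OrbitSpace m X)) (hA : A = orbitSpaceFiltration l m 1 X l)
          (hq : q ∈ A), HasEuclideanChart l (⟨q, hq⟩ : A) := by
        rintro A rfl hq'
        obtain ⟨x, rfl⟩ := orbitMk_surjective q
        obtain ⟨N, -, hN, -⟩ := hX.exists_isLink_orbitMk ((hX.orbitMk_mem_zero_iff x).1 hq)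
        exact HasLinkChart.hasEuclideanChart_stratum ⟨_, hq'⟩ hN
      exact key _ hS hq
    · exact hFQ.isManifoldOfDim_top hch hp
  · rw [← (isOpenQuotientMap_orbitMk (m := m) (X := X)).dense_preimage_iff]
    convert hX.dense_compl_nonfreePoints using 1
    ext x
    exact hX.orbitMk_mem_one_iff x
  · obtain rfl | rfl : i = 0 ∨ i = 1 := by omega
    · obtain ⟨x, rfl⟩ := orbitMk_surjective p
      obtain ⟨N, _, hN, -⟩ := hX.exists_isLink_orbitMk ((hX.orbitMk_mem_zero_iff x).1 hp)
      exact ⟨_, _, _, inferInstance, Or.inr ⟨0, 0, rfl, isStratPseudomanifold_discrete _⟩, hN⟩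
    · exact hFQ.exists_empty_link (hch p hp)

theorem isNormalStrat_orbitSpace_iff (hX : IsLocallyStandard l m 1 X) :
    IsNormalStrat l 1 (OrbitSpace m X) (orbitSpaceFiltration l m 1 X) ↔
      ∀ x ∈ nonfreePoints m X, LocallyPreconnectedCompl (nonfreePoints m X) x := by
  constructor
  · rintro ⟨-, h⟩ x hx
    obtain ⟨N, _, hN, hiff⟩ := hX.exists_isLink_orbitMk hx
    exact hiff.1 (h 0 (by omega) _ ((hX.orbitMk_mem_zero_iff x).2 hx) _ _
      ⟨inferInstance, Or.inr ⟨0, 0, rfl, isStratPseudomanifold_discrete _⟩, hN⟩)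
  · intro h
    refine ⟨hX.isStratPseudomanifold_orbitSpace, fun i hi p hp L _ G hL => ?_⟩
    obtain rfl | rfl : i = 0 ∨ i = 1 := by omega
    · obtain ⟨x, rfl⟩ := orbitMk_surjective p
      have hx := (hX.orbitMk_mem_zero_iff x).1 hp
      obtain ⟨N, _, hN, hiff⟩ := hX.exists_isLink_orbitMk hx
      have hpl : orbitMk m x ∈ orbitSpaceFiltration l m 1 X l :=
        (hX.orbitMk_mem_iff _ _).2 (Or.inr ⟨le_rfl, hx⟩)
      have := hL.1
      -- Local separation by the singular stratum transfers connectedness from the explicit finite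
      -- link to the arbitrary link `L`.
      exact (HasLinkChart.locallyPreconnectedCompl_iff hpl hL.2.2).1
        ((HasLinkChart.locallyPreconnectedCompl_iff hpl hN).2 (hiff.2 (h x hx)))
    · have := hL.isEmpty
      exact preconnectedSpace_of_isEmpty L

end IsLocallyStandard

end

theorem mainTheorem7 {X : Type u} [TopologicalSpace X] (l m n : ℕ) [MulAction (Torus m) X]
    (hX : IsLocallyStandard l m n X) (hdim : l + m + n ≤ 3) :
    (IsTopologicalManifold X ↔
      IsNormalStrat (l + (m - n)) (2 * n) X (orbitFiltration l m n X)) ∧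
    (IsTopologicalManifold X ↔ HasConnectedTorusLinks l m n X) ∧
    (IsTopologicalManifold X ↔
      IsNormalStrat l n (OrbitSpace m X) (orbitSpaceFiltration l m n X)) := by
  have hnm := hX.le
  -- Here `2 * n ≤ m + n ≤ 3`.
  obtain rfl | rfl : n = 0 ∨ n = 1 := by omega
  · obtain ⟨h1, h2, h3, h4⟩ := hX.zero
    exact ⟨iff_of_true h1 h2, iff_of_true h1 h3, iff_of_true h1 h4⟩
  · have h := hX.isTopologicalManifold_iff (by omega)
    exact ⟨h.trans hX.isNormalStrat_iff.symm, h.trans hX.hasConnectedTorusLinks_iff.symm,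
      h.trans hX.isNormalStrat_orbitSpace_iff.symm⟩
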